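/- Let $\mathbf X=(X_1,\dots,X_n)$ be a random vector on a probability space $(\Omega,\mathcal F,\mathbb P)$, let $S=\sum_{i=1}^n X_i$, and let $\mathbf X^{(1)},\mathbf X^{(2)},\dots$ be i.i.d. samples of $\mathbf X$ on the same space. Let $F_i$ and $G$ be the distribution functions of $X_i$ and $S$, and let $\alpha\in(0,1)$. For $\phi=\mathrm{VaR}_\alpha$, where $\mathrm{VaR}_\alpha(Y)=\inf\{x\in\mathbb R:\mathbb P(Y\le x)\ge 1-\alpha\}$, or $\phi=\mathrm{ES}_\alpha$, where $\mathrm{ES}_\alpha(Y)=\frac1\alpha\int_0^\alpha \mathrm{VaR}_\beta(Y)\,d\beta$, let $$\mathrm{DR}^{\phi}(\mathbf X)=\frac{\phi(S)}{\sum_{i=1}^n\phi(X_i)},$$ and let $\widehat{\mathrm{DR}^{\phi}}(N)$ be the value of $\mathrm{DR}^\phi$ at the empirical distribution of $\mathbf X^{(1)},\dots,\mathbf X^{(N)}$. Put $t_i=\mathrm{VaR}_\alpha(X_i)$, $s=\mathrm{VaR}_\alpha(S)$, $t_{n+1}=\sum_{i=1}^n t_i$. (i) Suppose that $t_{n+1}\neq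 0$, that each $F_i$ is differentiable at $t_i$ with $f_i(t_i):=F_i'(t_i)>0$, and that $G$ is differentiable at $s$ with $g(s):=G'(s)>0$. Then, as $N\to\infty$, $$\sqrt N\left(\widehat{\mathrm{DR}^{\mathrm{VaR}_\alpha}}(N)-\mathrm{DR}^{\mathrm{VaR}_\alpha}(\mathbf X)\right)\xrightarrow{d}\mathrm N(0,\widetilde\sigma^2_{\mathrm{VaR}}(\mathbf X)),\qquad \widetilde\sigma^2_{\mathrm{VaR}}(\mathbf X)=\mathbf R_{\mathrm{VaR}}^\top\Sigma_{\mathrm{VaR}}\mathbf R_{\mathrm{VaR}},$$ where $$\mathbf R_{\mathrm{VaR}}=\left(\frac{s}{f_1(t_1)t_{n+1}^2},\dots,\frac{s}{f_n(t_n)t_{n+1}^2},\frac{-1}{g(s)t_{n+1}}\right)$$ and $\Sigma_{\mathrm{VaR}}$ is the covariance matrix of $(\mathbf 1_{\{X_1\le t_1\}},\dots,\mathbf 1_{\{X_n\le t_n\}},\mathbf 1_{\{S\le s\}})$. (ii) Suppose that $\sum_{i=1}^n\mathrm{ES}_\alpha(X_i)\ne0$, that for each $i$ the law of $X_i$ has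 a Lebesgue density on $[t_i,\infty)$ which is positive there and $\mathbb E[|X_i|^{2+\epsilon_i}]<\infty$ for some $\epsilon_i>0$, and that the $(1-\alpha)$-quantile of $S$ is unique, that is, $G(x)>1-\alpha$ for all $x>s$ (for instance, $S$ has a density which is positive on $[s,\infty)$). Then, as $N\to\infty$, $$\sqrt N\left(\widehat{\mathrm{DR}^{\mathrm{ES}_\alpha}}(N)-\mathrm{DR}^{\mathrm{ES}_\alpha}(\mathbf X)\right)\xrightarrow{d}\mathrm N(0,\widetilde\sigma^2_{\mathrm{ES}}(\mathbf X)),\qquad \widetilde\sigma^2_{\mathrm{ES}}(\mathbf X)=\mathbf R_{\mathrm{ES}}^\top\Sigma_{\mathrm{ES}}\mathbf R_{\mathrm{ES}},$$ where $$\mathbf R_{\mathrm{ES}}=\frac1\alpha\left(-\frac{\mathrm{ES}_\alpha(S)}{(\sum_{i}\mathrm{ES}_\alpha(X_i))^2},\dots,-\frac{\mathrm{ES}_\alpha(S)}{(\sum_{i}\mathrm{ES}_\alpha(X_i))^2},\frac1{\sum_{i}\mathrm{ES}_\alpha(X_i)}\right)$$ and $\Sigma_{\mathrm{ES}}$ is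 the covariance matrix of $((X_1-t_1)_+,\dots,(X_n-t_n)_+,(S-s)_+)$. Moreover, under the hypotheses of (i) with $\phi=\mathrm{VaR}_\alpha$, respectively of (ii) with $\phi=\mathrm{ES}_\alpha$, the asymptotic variance blows up when a shift of location makes the sum of the individual risks tend to zero: unless both $\mathrm{DR}^\phi(\mathbf X)=1$ and $\widetilde\sigma^2_\phi(\mathbf X)=0$, one has $\widetilde\sigma^2_\phi(\mathbf X+\mathbf c)\to\infty$ as $\mathbf c\in\mathbb R^n$ varies so that $\sum_{i=1}^n\phi(X_i+c_i)\to0$ through nonzero values. -/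

import Mathlib

open MeasureTheory ProbabilityTheory Filter Topology
open scoped ENNReal Matrix

noncomputable section

namespace DivRatio

/-- Distribution function `x ↦ ν (-∞, x]` of a law `ν` on the real line. -/
def distFun (ν : Measure ℝ) (x : ℝ) : ℝ := ν.real (Set.Iic x)

/-- Value at Risk of the law `ν` at level `α` (small-`α` convention), i.e. the left quantile
`F⁻¹(1 - α) = inf {x | F x ≥ 1 - α}`. -/
def VaR (α : ℝ) (ν : Measure ℝ) : ℝ := sInf {x : ℝ | 1 - α ≤ distFun ν x}

/-- Expected Shortfall of the law `ν` at level `α`. -/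
def ES (α : ℝ) (ν : Measure ℝ) : ℝ := (1 / α) * ∫ β in (0 : ℝ)..α, VaR β ν

/-- The density at the point `x` of the distribution function of `ν`. -/
def densityAt (ν : Measure ℝ) (x : ℝ) : ℝ := deriv (distFun ν) x

/-- The distribution function of `ν` is differentiable at `x` with a positive derivative. -/
def HasPositiveDensityAt (ν : Measure ℝ) (x : ℝ) : Prop :=
  DifferentiableAt ℝ (distFun ν) x ∧ 0 < densityAt ν x

/-- On the set `A` the law `ν` has a Lebesgue density which is positive at every point of `A`. -/
def HasPositiveDensityOn (ν : Measure ℝ) (A : Set ℝ) : Prop :=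
  ∃ f : ℝ → ℝ, Measurable f ∧ (∀ x ∈ A, 0 < f x) ∧
    ν.restrict A = (volume.restrict A).withDensity (fun x => ENNReal.ofReal (f x))

variable {Ω : Type*} [MeasurableSpace Ω] {n : ℕ}

/-- The law of the `i`-th loss `X_i`. -/
def margLaw (μ : Measure Ω) (X : Ω → Fin n → ℝ) (i : Fin n) : Measure ℝ :=
  μ.map (fun ω => X ω i)

/-- The law of the total loss `S = X_1 + ⋯ + X_n`. -/
def sumLaw (μ : Measure Ω) (X : Ω → Fin n → ℝ) : Measure ℝ :=
  μ.map (fun ω => ∑ i, X ω i)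

/-- The diversification ratio `φ(S) / ∑ φ(X_i)` of the portfolio `X` for a law-invariant
risk measure `φ`. -/
def DR (φ : Measure ℝ → ℝ) (μ : Measure Ω) (X : Ω → Fin n → ℝ) : ℝ :=
  φ (sumLaw μ X) / ∑ i, φ (margLaw μ X i)

/-- The empirical distribution `(1 / N) ∑_{k < N} δ_{x k}` of the first `N` points. -/
def empiricalMeasure (x : ℕ → Fin n → ℝ) (N : ℕ) : Measure (Fin n → ℝ) :=
  (N : ℝ≥0∞)⁻¹ • ∑ k ∈ Finset.range N, Measure.dirac (x k)

/-- The empirical estimator of the diversification ratio: the diversification ratio of a random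
vector distributed according to the empirical distribution of the first `N` samples. -/
def empDR (φ : Measure ℝ → ℝ) (x : ℕ → Fin n → ℝ) (N : ℕ) : ℝ :=
  DR φ (empiricalMeasure x N) (fun y : Fin n → ℝ => y)

/-- The covariance matrix of a random vector. -/
def covMat (μ : Measure Ω) {m : ℕ} (Y : Ω → Fin m → ℝ) : Matrix (Fin m) (Fin m) ℝ :=
  Matrix.of fun i j => covariance (fun ω => Y ω i) (fun ω => Y ω j) μ

/-- The vector `R_VaR`. -/
def weightVaR (α : ℝ) (μ : Measure Ω) (X : Ω → Fin n → ℝ) : Fin (n + 1) → ℝ :=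
  Fin.snoc (α := fun _ => ℝ)
    (fun i : Fin n => VaR α (sumLaw μ X) /
      (densityAt (margLaw μ X i) (VaR α (margLaw μ X i)) *
        (∑ j, VaR α (margLaw μ X j)) ^ 2))
    (-1 / (densityAt (sumLaw μ X) (VaR α (sumLaw μ X)) * ∑ j, VaR α (margLaw μ X j)))

/-- The random vector `(1_{X_1 ≤ t_1}, …, 1_{X_n ≤ t_n}, 1_{S ≤ s})`, where `t_i` and `s` are the
`(1 - α)`-quantiles of `X_i` and `S`. -/
def indicatorVec (α : ℝ) (μ : Measure Ω) (X : Ω → Fin n → ℝ) (ω : Ω) : Fin (n + 1) → ℝ :=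
  Fin.snoc (α := fun _ => ℝ)
    (fun i : Fin n => Set.indicator (Set.Iic (VaR α (margLaw μ X i))) (fun _ => (1 : ℝ)) (X ω i))
    (Set.indicator (Set.Iic (VaR α (sumLaw μ X))) (fun _ => (1 : ℝ)) (∑ i, X ω i))

/-- The asymptotic variance `R_VaRᵀ Σ_VaR R_VaR`. -/
def asymVarVaR (α : ℝ) (μ : Measure Ω) (X : Ω → Fin n → ℝ) : ℝ :=
  weightVaR α μ X ⬝ᵥ (covMat μ (indicatorVec α μ X) *ᵥ weightVaR α μ X)

/-- The vector `R_ES`. -/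
def weightES (α : ℝ) (μ : Measure Ω) (X : Ω → Fin n → ℝ) : Fin (n + 1) → ℝ :=
  (1 / α) • (Fin.snoc (α := fun _ => ℝ)
    (fun _ : Fin n => -(ES α (sumLaw μ X) / (∑ j, ES α (margLaw μ X j)) ^ 2))
    (1 / ∑ j, ES α (margLaw μ X j)) : Fin (n + 1) → ℝ)

/-- The random vector `((X_1 - t_1)_+, …, (X_n - t_n)_+, (S - s)_+)`, where `t_i` and `s` are the
`(1 - α)`-quantiles of `X_i` and `S`. -/
def excessVec (α : ℝ) (μ : Measure Ω) (X : Ω → Fin n → ℝ) (ω : Ω) : Fin (n + 1) → ℝ :=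
  Fin.snoc (α := fun _ => ℝ)
    (fun i : Fin n => max (X ω i - VaR α (margLaw μ X i)) 0)
    (max ((∑ i, X ω i) - VaR α (sumLaw μ X)) 0)

/-- The asymptotic variance `R_ESᵀ Σ_ES R_ES`. -/
def asymVarES (α : ℝ) (μ : Measure Ω) (X : Ω → Fin n → ℝ) : ℝ :=
  weightES α μ X ⬝ᵥ (covMat μ (excessVec α μ X) *ᵥ weightES α μ X)

end DivRatio

end

open DivRatio

open MeasureTheory ProbabilityTheory Filter Topology
open scoped ENNReal Matrix
noncomputable section

set_option linter.unusedSectionVars false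

/-! Each empirical risk measure is, after centring and scaling by √N, a normalised i.i.d. sum up to
an error vanishing in probability. For VaR this is Bahadur's representation, with influence function
-1_{x ≤ t} / f(t) up to a constant. Ghosh's lemma (`SmallOP.sub_of_comparison`) reduces it to
comparing distribution functions at the points t + y/√N. For ES the Rockafellar–Uryasev function
`ruFun` is minimised at the quantile, with minimum ES. Evaluating the empirical `ruFun` at the true
quantile instead of the empirical one therefore costs at most the quantile error times a term of
order N^(-1/2), which is negligible as soon as the quantile is consistent.

The delta method (`SmallOP.div_sub_div`) linearises the quotient. Since S and the X_i are functions
of the same sample vector, the linearised ratio is a single scalar i.i.d. sum, so the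
one-dimensional central limit theorem and Slutsky's lemma suffice (`tendstoInDistribution_empDR`).
The quadratic form in the covariance matrix is the variance of one summand.

For the blow-up, let B and A be the fluctuations of numerator and denominator. A location shift
leaves both unchanged and adds the same constant to numerator and denominator, so their difference d
is fixed. With denominator τ the variance is Var(-(d + τ)/τ² · A + B/τ). It grows like d² Var(A)/τ⁴
if d and Var(A) are nonzero, like Var(B)/τ² if d ≠ 0 and A is degenerate, and equals Var(B - A)/τ²
if d = 0. -/

/-- The sequence `f` of random variables converges to zero in probability. -/
def SmallOP {Ω : Type*} [MeasurableSpace Ω] (μ : Measure Ω) (f : ℕ → Ω → ℝ) : Prop :=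
  ∀ ε > 0, Tendsto (fun N => μ.real {ω | ε ≤ |f N ω|}) atTop (𝓝 0)

/-- The sequence `f` of random variables is bounded in probability. -/
def BigOP {Ω : Type*} [MeasurableSpace Ω] (μ : Measure Ω) (f : ℕ → Ω → ℝ) : Prop :=
  ∀ ε > 0, ∃ K > 0, ∀ᶠ N in atTop, μ.real {ω | K ≤ |f N ω|} ≤ ε

/-! ### Calculus of convergence and boundedness in probability -/

section Calculus

variable {Ω : Type*} [MeasurableSpace Ω] {μ : Measure Ω} [IsFiniteMeasure μ] {f g : ℕ → Ω → ℝ}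

theorem tendsto_measureReal_of_le {A B : ℕ → Set Ω}
    (hB : Tendsto (fun N => μ.real (B N)) atTop (𝓝 0)) (h : ∀ᶠ N in atTop, A N ⊆ B N) :
    Tendsto (fun N => μ.real (A N)) atTop (𝓝 0) := by
  refine tendsto_of_tendsto_of_tendsto_of_le_of_le' tendsto_const_nhds hB
    (Eventually.of_forall fun _ => measureReal_nonneg) ?_
  filter_upwards [h] with N hN using measureReal_mono hN

theorem tendsto_measureReal_union {A B : ℕ → Set Ω}
    (hA : Tendsto (fun N => μ.real (A N)) atTop (𝓝 0))
    (hB : Tendsto (fun N => μ.real (B N)) atTop (𝓝 0)) :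
    Tendsto (fun N => μ.real (A N ∪ B N)) atTop (𝓝 0) := by
  have := hA.add hB
  rw [add_zero] at this
  exact tendsto_of_tendsto_of_tendsto_of_le_of_le tendsto_const_nhds this
    (fun _ => measureReal_nonneg) fun N => measureReal_union_le _ _

theorem SmallOP.tendstoInMeasure (hf : SmallOP μ f) : TendstoInMeasure μ f atTop 0 := by
  rw [tendstoInMeasure_iff_measureReal_norm]
  intro ε hε
  simpa using hf ε hε

/-- Serves when a bound fails only on an event of vanishing probability, such as a random
denominator coming close to zero. -/
theorem SmallOP.of_le_off (hf : SmallOP μ f) {E : ℕ → Set Ω}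
    (hE : Tendsto (fun N => μ.real (E N)) atTop (𝓝 0))
    (h : ∀ᶠ N in atTop, ∀ ω ∉ E N, |g N ω| ≤ |f N ω|) : SmallOP μ g := by
  intro ε hε
  refine tendsto_measureReal_of_le (tendsto_measureReal_union (hf ε hε) hE) ?_
  filter_upwards [h] with N hN ω hω
  by_cases hωE : ω ∈ E N
  · exact Or.inr hωE
  · exact Or.inl (le_trans hω (hN ω hωE))

theorem SmallOP.of_le (hf : SmallOP μ f) (h : ∀ᶠ N in atTop, ∀ ω, |g N ω| ≤ |f N ω|) :
    SmallOP μ g :=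
  hf.of_le_off (E := fun _ => ∅) (by simp) (h.mono fun _ h ω _ => h ω)

theorem SmallOP.congr (hf : SmallOP μ f) (h : ∀ᶠ N in atTop, ∀ ω, g N ω = f N ω) : SmallOP μ g :=
  hf.of_le (h.mono fun _ h ω => (congrArg abs (h ω)).le)

theorem SmallOP.add (hf : SmallOP μ f) (hg : SmallOP μ g) :
    SmallOP μ (fun N ω => f N ω + g N ω) := by
  intro ε hε
  refine tendsto_measureReal_of_le
    (tendsto_measureReal_union (hf (ε / 2) (by positivity)) (hg (ε / 2) (by positivity))) ?_
  refine Eventually.of_forall fun N ω hω => ?_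
  simp only [Set.mem_ofPred_eq, Set.mem_union] at hω ⊢
  by_contra! hc
  linarith [abs_add_le (f N ω) (g N ω)]

theorem SmallOP.of_tendsto {a : ℕ → ℝ} (ha : Tendsto a atTop (𝓝 0)) :
    SmallOP μ (fun N _ => a N) := by
  intro ε hε
  have : ∀ᶠ N in atTop, |a N| < ε := by
    simpa using (Metric.tendsto_nhds.1 ha ε hε)
  refine tendsto_measureReal_of_le (B := fun _ => ∅) (by simp) ?_
  filter_upwards [this] with N hN ω hω
  exact absurd hω (not_le.2 hN)

theorem SmallOP.bigOP (hf : SmallOP μ f) : BigOP μ f := fun _ hε =>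
  ⟨1, one_pos, ((hf 1 one_pos).eventually_lt_const hε).mono fun _ h => h.le⟩

theorem BigOP.of_le (hf : BigOP μ f) (h : ∀ᶠ N in atTop, ∀ ω, |g N ω| ≤ |f N ω|) :
    BigOP μ g := by
  intro ε hε
  obtain ⟨K, hK, hN⟩ := hf ε hε
  refine ⟨K, hK, ?_⟩
  filter_upwards [hN, h] with N hN h
  exact (measureReal_mono fun ω hω => le_trans hω (h ω)).trans hN

theorem BigOP.add (hf : BigOP μ f) (hg : BigOP μ g) : BigOP μ (fun N ω => f N ω + g N ω) := by
  intro ε hε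
  obtain ⟨K, hK, hN⟩ := hf (ε / 2) (by positivity)
  obtain ⟨L, hL, hM⟩ := hg (ε / 2) (by positivity)
  refine ⟨K + L, by positivity, ?_⟩
  filter_upwards [hN, hM] with N hN hM
  have : {ω | K + L ≤ |f N ω + g N ω|} ⊆ {ω | K ≤ |f N ω|} ∪ {ω | L ≤ |g N ω|} := by
    intro ω hω
    simp only [Set.mem_ofPred_eq, Set.mem_union] at hω ⊢
    by_contra! hc
    linarith [abs_add_le (f N ω) (g N ω)]
  linarith [measureReal_mono (μ := μ) this,
    measureReal_union_le (μ := μ) {ω | K ≤ |f N ω|} {ω | L ≤ |g N ω|}]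

theorem BigOP.const_mul (hf : BigOP μ f) (c : ℝ) : BigOP μ (fun N ω => c * f N ω) := by
  intro ε hε
  obtain ⟨K, hK, hN⟩ := hf ε hε
  refine ⟨(|c| + 1) * K, by positivity, ?_⟩
  filter_upwards [hN] with N hN
  refine (measureReal_mono fun ω hω => ?_).trans hN
  simp only [Set.mem_ofPred_eq, abs_mul] at hω ⊢
  by_contra! hc
  have := mul_le_mul_of_nonneg_left hc.le (abs_nonneg c)
  have : (0 : ℝ) < |c| + 1 := by positivity
  nlinarith

theorem SmallOP.mul_bigOP (hf : SmallOP μ f) (hg : BigOP μ g) :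
    SmallOP μ (fun N ω => f N ω * g N ω) := by
  intro ε hε
  rw [Metric.tendsto_nhds]
  intro δ hδ
  obtain ⟨K, hK, hN⟩ := hg (δ / 2) (by positivity)
  filter_upwards [hN, (hf (ε / K) (by positivity)).eventually_lt_const (half_pos hδ)] with N hN hM
  have : {ω | ε ≤ |f N ω * g N ω|} ⊆ {ω | ε / K ≤ |f N ω|} ∪ {ω | K ≤ |g N ω|} := by
    intro ω hω
    simp only [Set.mem_ofPred_eq, Set.mem_union, abs_mul] at hω ⊢
    by_contra! hc
    have h1 : |f N ω| * |g N ω| < (ε / K) * K :=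
      mul_lt_mul'' hc.1 hc.2 (abs_nonneg _) (abs_nonneg _)
    rw [div_mul_cancel₀ _ hK.ne'] at h1
    linarith
  rw [Real.dist_0_eq_abs, abs_of_nonneg measureReal_nonneg]
  linarith [measureReal_mono (μ := μ) this,
    measureReal_union_le (μ := μ) {ω | ε / K ≤ |f N ω|} {ω | K ≤ |g N ω|}]

theorem SmallOP.const_mul (hf : SmallOP μ f) (c : ℝ) : SmallOP μ (fun N ω => c * f N ω) := by
  have hb : BigOP μ (fun (_ : ℕ) (_ : Ω) => c) := fun ε hε => ⟨|c| + 1, by positivity,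
    Eventually.of_forall fun N => by
      have : {ω : Ω | |c| + 1 ≤ |c|} = ∅ := by ext; simp
      rw [this, measureReal_empty]
      exact hε.le⟩
  exact (hf.mul_bigOP hb).congr (Eventually.of_forall fun N ω => mul_comm _ _)

theorem SmallOP.sum {ι : Type*} (s : Finset ι) {F : ι → ℕ → Ω → ℝ}
    (hF : ∀ i ∈ s, SmallOP μ (F i)) : SmallOP μ (fun N ω => ∑ i ∈ s, F i N ω) := by
  classical
  induction s using Finset.induction_on with
  | empty => simpa using SmallOP.of_tendsto (μ := μ) (a := fun _ => 0) tendsto_const_nhds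
  | insert a s ha ih =>
    simp only [Finset.sum_insert ha]
    exact (hF a (by simp)).add (ih fun i hi => hF i (by simp [hi]))

theorem BigOP.sum {ι : Type*} (s : Finset ι) {F : ι → ℕ → Ω → ℝ}
    (hF : ∀ i ∈ s, BigOP μ (F i)) : BigOP μ (fun N ω => ∑ i ∈ s, F i N ω) := by
  classical
  induction s using Finset.induction_on with
  | empty => simpa using (SmallOP.of_tendsto (μ := μ) (a := fun _ => 0) tendsto_const_nhds).bigOP
  | insert a s ha ih =>
    simp only [Finset.sum_insert ha]
    exact (hF a (by simp)).add (ih fun i hi => hF i (by simp [hi]))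

theorem tendsto_inv_sqrt_natCast : Tendsto (fun N : ℕ => (√(N : ℝ))⁻¹) atTop (𝓝 0) :=
  tendsto_inv_atTop_zero.comp
    (Real.tendsto_sqrt_atTop.comp tendsto_natCast_atTop_atTop)

/-- A √N rate implies consistency. -/
theorem SmallOP.of_sqrt_mul (hf : BigOP μ (fun N ω => √(N : ℝ) * f N ω)) : SmallOP μ f := by
  refine ((SmallOP.of_tendsto (μ := μ) tendsto_inv_sqrt_natCast).mul_bigOP hf).congr ?_
  filter_upwards [eventually_gt_atTop 0] with N hN ω
  have : √(N : ℝ) ≠ 0 := by positivity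
  field_simp

/-- Ghosh's lemma: if `g` is bounded in probability and, for every threshold, `f` and `g` lie on
opposite sides of it by a margin with vanishing probability only, then `f - g` converges to zero in
probability. -/
theorem SmallOP.sub_of_comparison (hg : BigOP μ g)
    (h₁ : ∀ y ε, 0 < ε → Tendsto (fun N => μ.real {ω | f N ω ≤ y ∧ y + ε ≤ g N ω}) atTop (𝓝 0))
    (h₂ : ∀ y ε, 0 < ε → Tendsto (fun N => μ.real {ω | y + ε ≤ f N ω ∧ g N ω ≤ y}) atTop (𝓝 0)) :
    SmallOP μ (fun N ω => f N ω - g N ω) := by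
  intro ε hε
  rw [Metric.tendsto_nhds]
  intro δ hδ
  obtain ⟨K, hK, hN⟩ := hg (δ / 2) (by positivity)
  -- a finite grid of mesh `ε / 2` covering `[-K, K]`
  obtain ⟨M, hM⟩ := exists_nat_gt (2 * K / (ε / 2) + 2)
  let y : ℕ → ℝ := fun j => -K + (j - 1) * (ε / 2)
  have hun : ∀ s : Finset ℕ, Tendsto (fun N => μ.real (⋃ j ∈ s,
      ({ω | f N ω ≤ y j ∧ y j + ε / 2 ≤ g N ω} ∪ {ω | y j + ε / 2 ≤ f N ω ∧ g N ω ≤ y j})))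
      atTop (𝓝 0) := by
    intro s
    have := tendsto_finsetSum s fun j _ => tendsto_measureReal_union
      (h₁ (y j) (ε / 2) (by positivity)) (h₂ (y j) (ε / 2) (by positivity))
    rw [Finset.sum_const_zero] at this
    exact tendsto_of_tendsto_of_tendsto_of_le_of_le tendsto_const_nhds this
      (fun _ => measureReal_nonneg) fun N => measureReal_biUnion_finset_le _ _
  filter_upwards [hN, (hun (Finset.range (M + 1))).eventually_lt_const (half_pos hδ)] with N hN hU
  have hsub : {ω | ε ≤ |f N ω - g N ω|} ⊆ {ω | K ≤ |g N ω|} ∪ ⋃ j ∈ Finset.range (M + 1),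
      ({ω | f N ω ≤ y j ∧ y j + ε / 2 ≤ g N ω} ∪ {ω | y j + ε / 2 ≤ f N ω ∧ g N ω ≤ y j}) := by
    intro ω hω
    by_cases hKω : K ≤ |g N ω|
    · exact Or.inl hKω
    right
    rw [not_le, abs_lt] at hKω
    simp only [Set.mem_ofPred_eq] at hω
    have hε2 : 0 < ε / 2 := by positivity
    -- the cell of the grid that contains `g N ω`
    set q := (g N ω + K) / (ε / 2) with hq
    have hq0 : 0 ≤ q := div_nonneg (by linarith) hε2.le
    have hqe : g N ω = -K + q * (ε / 2) := by rw [hq]; field_simp; ring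
    have hfl := Nat.floor_le hq0
    have hlt := Nat.lt_floor_add_one q
    have hqM : q < 2 * K / (ε / 2) := by
      rw [hq]; exact div_lt_div_of_pos_right (by linarith) hε2
    have hflM : ⌊q⌋₊ + 2 < M + 1 := by
      have : ((⌊q⌋₊ + 2 : ℕ) : ℝ) < M := by push_cast; linarith
      have : ⌊q⌋₊ + 2 < M := by exact_mod_cast this
      omega
    simp only [Set.mem_iUnion, Finset.mem_range, Set.mem_union, Set.mem_ofPred_eq]
    -- If `f` exceeds `g`, the threshold is the upper edge of the cell of `g`; otherwise it lies one
    -- mesh below the lower edge. The shift `j - 1` in `y` keeps the latter index a natural number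
    -- even when `g` is in the first cell.
    rcases le_abs.1 hω with h | h
    · refine ⟨⌊q⌋₊ + 2, hflM, Or.inr ?_⟩
      simp only [y]; push_cast
      constructor <;> nlinarith
    · refine ⟨⌊q⌋₊, by omega, Or.inl ?_⟩
      simp only [y]
      constructor <;> nlinarith
  rw [Real.dist_0_eq_abs, abs_of_nonneg measureReal_nonneg]
  have h3 := measureReal_mono (μ := μ) hsub
  have h4 := measureReal_union_le (μ := μ) {ω | K ≤ |g N ω|} (⋃ j ∈ Finset.range (M + 1),
      ({ω | f N ω ≤ y j ∧ y j + ε / 2 ≤ g N ω} ∪ {ω | y j + ε / 2 ≤ f N ω ∧ g N ω ≤ y j}))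
  linarith

/-- The delta method for the quotient of two estimators. -/
theorem SmallOP.div_sub_div {A B U V : ℕ → Ω → ℝ} {a b : ℝ} (hb : b ≠ 0)
    (hU : BigOP μ U) (hV : BigOP μ V)
    (hA : SmallOP μ (fun N ω => √(N : ℝ) * (A N ω - a) - U N ω))
    (hB : SmallOP μ (fun N ω => √(N : ℝ) * (B N ω - b) - V N ω)) :
    SmallOP μ (fun N ω => √(N : ℝ) * (A N ω / B N ω - a / b) -
      (1 / b * U N ω - a / b ^ 2 * V N ω)) := by
  have hP : BigOP μ (fun N ω => √(N : ℝ) * (A N ω - a)) := by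
    refine (hA.bigOP.add hU).of_le (Eventually.of_forall fun N ω => le_of_eq ?_)
    congr 1; ring
  have hQ : BigOP μ (fun N ω => √(N : ℝ) * (B N ω - b)) := by
    refine (hB.bigOP.add hV).of_le (Eventually.of_forall fun N ω => le_of_eq ?_)
    congr 1; ring
  have hBs : SmallOP μ (fun N ω => B N ω - b) := .of_sqrt_mul hQ
  have hR : BigOP μ (fun N ω => b * (√(N : ℝ) * (A N ω - a)) +
      (-a) * (√(N : ℝ) * (B N ω - b))) := (hP.const_mul b).add (hQ.const_mul (-a))
  -- The linearisation error is exactly (B - b) times a bounded-in-probability combination of the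
  -- scaled errors, divided by -b² B. Off the event |B - b| ≥ |b|/2 one has |B| ≥ |b|/2, hence the
  -- constant 2/|b|³.
  have hmain : SmallOP μ (fun N ω => √(N : ℝ) * (A N ω / B N ω - a / b) -
      (1 / b * (√(N : ℝ) * (A N ω - a)) - a / b ^ 2 * (√(N : ℝ) * (B N ω - b)))) := by
    have h1 := (hBs.mul_bigOP hR).const_mul (2 / |b| ^ 3)
    refine h1.of_le_off (hBs (|b| / 2) (by positivity)) (Eventually.of_forall fun N ω hω => ?_)
    simp only [Set.mem_ofPred_eq, not_le] at hω
    have hBpos : |b| / 2 ≤ |B N ω| := by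
      have := abs_sub_abs_le_abs_sub b (B N ω)
      rw [abs_sub_comm] at this
      linarith
    have hb' : 0 < |b| := abs_pos.2 hb
    have hB0 : B N ω ≠ 0 := by
      intro h; rw [h, abs_zero] at hBpos; linarith
    have e : √(N : ℝ) * (A N ω / B N ω - a / b) -
      (1 / b * (√(N : ℝ) * (A N ω - a)) - a / b ^ 2 * (√(N : ℝ) * (B N ω - b))) =
      (-1 / (b ^ 2 * B N ω)) * ((B N ω - b) * (b * (√(N : ℝ) * (A N ω - a)) +
        (-a) * (√(N : ℝ) * (B N ω - b)))) := by
      field_simp; ring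
    rw [e, abs_mul, abs_mul (2 / |b| ^ 3)]
    refine mul_le_mul_of_nonneg_right ?_ (abs_nonneg _)
    rw [abs_div, abs_neg, abs_one, abs_mul, abs_pow, abs_div, abs_two, abs_pow, abs_abs,
      div_le_div_iff₀ (by positivity) (by positivity)]
    nlinarith [pow_pos hb' 2]
  refine (hmain.add ((hA.const_mul (1 / b)).add (hB.const_mul (-(a / b ^ 2))))).congr
    (Eventually.of_forall fun N ω => ?_)
  ring

end Calculus

/-! ### Normalised i.i.d. sums -/

/-- The centred and normalised partial sum `N ^ (-1/2) * (∑_{k < N} η k - N * m)`. -/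
def normSum {Ω : Type*} (η : ℕ → Ω → ℝ) (m : ℝ) (N : ℕ) (ω : Ω) : ℝ :=
  (√(N : ℝ))⁻¹ * (∑ k ∈ Finset.range N, η k ω - N * m)

section NormSum

variable {Ω : Type*} [MeasurableSpace Ω] {μ : Measure Ω} [IsProbabilityMeasure μ]

/-- Chebyshev's inequality. The bound does not depend on N because the normalised sum has the
variance of a single term. -/
theorem measureReal_le_normSum {η : ℕ → Ω → ℝ} {ζ : Ω → ℝ} (hζ : MemLp ζ 2 μ)
    (hindep : iIndepFun η μ) (hident : ∀ k, IdentDistrib (η k) ζ μ μ) {N : ℕ} (hN : 0 < N)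
    {ε : ℝ} (hε : 0 < ε) :
    μ.real {ω | ε ≤ |normSum η (∫ ω, ζ ω ∂μ) N ω|} ≤ variance ζ μ / ε ^ 2 := by
  have hL : ∀ k, MemLp (η k) 2 μ := fun k => (hident k).memLp_iff.2 hζ
  have hS : MemLp (∑ k ∈ Finset.range N, η k) 2 μ := memLp_finsetSum' _ fun k _ => hL k
  have hv : variance (∑ k ∈ Finset.range N, η k) μ = N * variance ζ μ := by
    rw [IndepFun.variance_sum (fun k _ => hL k)
      (fun i _ j _ hij => hindep.indepFun hij)]
    simp [fun k => (hident k).variance_eq]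
  have hm : ∫ ω, (∑ k ∈ Finset.range N, η k) ω ∂μ = N * ∫ ω, ζ ω ∂μ := by
    simp only [Finset.sum_apply]
    rw [integral_finsetSum _ fun k _ => (hL k).integrable one_le_two]
    simp [fun k => (hident k).integral_eq]
  have hN' : (0 : ℝ) < √N := by positivity
  have h := meas_ge_le_variance_div_sq hS (c := ε * √N) (by positivity)
  rw [hm, hv] at h
  have hset : {ω | ε ≤ |normSum η (∫ ω, ζ ω ∂μ) N ω|} =
      {ω | ε * √N ≤ |(∑ k ∈ Finset.range N, η k) ω - N * ∫ ω, ζ ω ∂μ|} := by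
    ext ω
    simp only [normSum, Set.mem_ofPred_eq, abs_mul, abs_inv, abs_of_pos hN', Finset.sum_apply]
    rw [← div_eq_inv_mul, le_div_iff₀ hN']
  rw [hset, measureReal_def]
  refine ENNReal.toReal_le_of_le_ofReal (by positivity [variance_nonneg ζ μ]) (h.trans_eq ?_)
  congr 1
  rw [mul_pow, Real.sq_sqrt (by positivity)]
  field_simp

theorem bigOP_normSum {η : ℕ → Ω → ℝ} {ζ : Ω → ℝ} (hζ : MemLp ζ 2 μ)
    (hindep : iIndepFun η μ) (hident : ∀ k, IdentDistrib (η k) ζ μ μ) :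
    BigOP μ (normSum η (∫ ω, ζ ω ∂μ)) := by
  intro ε hε
  have hv := variance_nonneg ζ μ
  -- The threshold makes the Chebyshev bound at most ε; the `+ 1` keeps it positive when the
  -- variance is zero.
  refine ⟨√(variance ζ μ / ε + 1), by positivity, ?_⟩
  filter_upwards [eventually_gt_atTop 0] with N hN
  refine (measureReal_le_normSum hζ hindep hident hN (by positivity)).trans ?_
  rw [Real.sq_sqrt (by positivity), div_le_iff₀ (by positivity)]
  field_simp
  linarith

theorem sqrt_mul_mean_sub {η : ℕ → Ω → ℝ} {m : ℝ} {N : ℕ} (hN : 0 < N) (ω : Ω) :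
    √(N : ℝ) * ((N : ℝ)⁻¹ * ∑ k ∈ Finset.range N, η k ω - m) = normSum η m N ω := by
  have h : (0 : ℝ) < N := by positivity
  have h1 := Real.sq_sqrt h.le
  have h0 : √(N : ℝ) ≠ 0 := by positivity
  rw [normSum]
  field_simp
  rw [h1]

/-- The central limit theorem combined with Slutsky's lemma. -/
theorem tendstoInDistribution_of_smallOP_sub_normSum {η : ℕ → Ω → ℝ} {ζ : Ω → ℝ}
    (hζ : MemLp ζ 2 μ) (hindep : iIndepFun η μ) (hident : ∀ k, IdentDistrib (η k) ζ μ μ)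
    {T : ℕ → Ω → ℝ} (hT : ∀ N, AEMeasurable (T N) μ)
    (h : SmallOP μ (fun N ω => T N ω - normSum η (∫ ω, ζ ω ∂μ) N ω)) :
    TendstoInDistribution T atTop (id : ℝ → ℝ) (fun _ => μ)
      (gaussianReal 0 (variance ζ μ).toNNReal) := by
  have hclt := tendstoInDistribution_inv_sqrt_mul_sum_sub (X := η) (P := μ) (Y := (id : ℝ → ℝ))
    (P' := gaussianReal 0 (variance ζ μ).toNNReal)
    (by rw [(hident 0).variance_eq]; exact HasLaw.id) ((hident 0).memLp_iff.2 hζ) hindep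
    (fun i => (hident i).trans (hident 0).symm)
  rw [(hident 0).integral_eq] at hclt
  exact tendstoInDistribution_of_tendstoInMeasure_sub T id hclt h.tendstoInMeasure hT

end NormSum

/-! ### Quantiles and the Rockafellar–Uryasev formula -/

section Quantile

variable {ν : Measure ℝ} [IsProbabilityMeasure ν] {α : ℝ}

theorem distFun_mono (ν : Measure ℝ) [IsFiniteMeasure ν] : Monotone (distFun ν) :=
  fun _ _ h => measureReal_mono (Set.Iic_subset_Iic.2 h)

theorem distFun_eq_cdf (ν : Measure ℝ) [IsProbabilityMeasure ν] : distFun ν = cdf ν :=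
  funext fun x => (cdf_eq_real ν x).symm

/-- Right continuity of the distribution function means that the infimum is attained. This
equivalence turns statements about quantiles into statements about distribution functions. -/
theorem VaR_le_iff (hα : α ∈ Set.Ioo (0 : ℝ) 1) {x : ℝ} :
    VaR α ν ≤ x ↔ 1 - α ≤ distFun ν x := by
  have hbdd : BddBelow {x : ℝ | 1 - α ≤ distFun ν x} := by
    have h := (tendsto_cdf_atBot ν).eventually_lt_const (show 0 < 1 - α by linarith [hα.2])
    obtain ⟨b, hb⟩ := eventually_atBot.1 h
    refine ⟨b, fun x hx => ?_⟩
    by_contra! hc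
    have h1 := hb x hc.le
    rw [← distFun_eq_cdf] at h1
    exact absurd hx (not_le.2 h1)
  have hne : {x : ℝ | 1 - α ≤ distFun ν x}.Nonempty := by
    have h := (tendsto_cdf_atTop ν).eventually_const_lt (show 1 - α < 1 by linarith [hα.1])
    obtain ⟨b, hb⟩ := h.exists
    exact ⟨b, by rw [← distFun_eq_cdf] at hb; exact hb.le⟩
  constructor
  · intro h
    rw [distFun_eq_cdf]
    have hrc : Tendsto (cdf ν) (𝓝[>] x) (𝓝 (cdf ν x)) :=
      ((cdf ν).right_continuous x).mono_left (nhdsWithin_mono _ Set.Ioi_subset_Ici_self)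
    refine ge_of_tendsto hrc ?_
    filter_upwards [self_mem_nhdsWithin] with z hz
    obtain ⟨w, hw, hwz⟩ := exists_lt_of_csInf_lt hne (lt_of_le_of_lt h hz)
    rw [← distFun_eq_cdf]
    exact le_trans hw (distFun_mono ν hwz.le)
  · exact fun h => csInf_le hbdd h

theorem lt_VaR_iff (hα : α ∈ Set.Ioo (0 : ℝ) 1) {x : ℝ} :
    x < VaR α ν ↔ distFun ν x < 1 - α := by
  rw [← not_le, VaR_le_iff hα, not_le]

theorem le_distFun_VaR (hα : α ∈ Set.Ioo (0 : ℝ) 1) : 1 - α ≤ distFun ν (VaR α ν) :=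
  (VaR_le_iff hα).1 le_rfl

theorem antitoneOn_VaR (ν : Measure ℝ) [IsProbabilityMeasure ν] :
    AntitoneOn (fun β => VaR β ν) (Set.Ioo 0 1) := by
  intro a ha b hb hab
  exact (VaR_le_iff hb).2 (by linarith [le_distFun_VaR (ν := ν) ha])

theorem aemeasurable_VaR (ν : Measure ℝ) [IsProbabilityMeasure ν] :
    AEMeasurable (fun β => VaR β ν) (volume.restrict (Set.Ioo 0 1)) :=
  aemeasurable_restrict_of_antitoneOn measurableSet_Ioo (antitoneOn_VaR ν)

/-- Quantile transform of a uniform variable: by `VaR_le_iff`, VaR at level β is at most x exactly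
when β ≥ 1 - F(x), a set of uniform measure F(x). -/
theorem map_VaR (ν : Measure ℝ) [IsProbabilityMeasure ν] :
    (volume.restrict (Set.Ioo 0 1)).map (fun β => VaR β ν) = ν := by
  have : IsFiniteMeasure ((volume.restrict (Set.Ioo (0 : ℝ) 1)).map (fun β => VaR β ν)) :=
    inferInstance
  refine Measure.ext_of_Iic _ _ fun x => ?_
  rw [Measure.map_apply_of_aemeasurable (aemeasurable_VaR ν) measurableSet_Iic]
  have h : ((fun β => VaR β ν) ⁻¹' Set.Iic x) =ᵐ[volume.restrict (Set.Ioo (0 : ℝ) 1)]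
      Set.Ici (1 - distFun ν x) := by
    refine (ae_restrict_mem measurableSet_Ioo).mono fun β hβ => ?_
    refine propext ?_
    change VaR β ν ≤ x ↔ 1 - distFun ν x ≤ β
    rw [VaR_le_iff hβ]
    constructor <;> intro h <;> linarith
  have h0 : 0 ≤ distFun ν x := measureReal_nonneg
  have h1 : distFun ν x ≤ 1 := measureReal_le_one
  rw [measure_congr h, Measure.restrict_congr_set Ioo_ae_eq_Icc,
    Measure.restrict_apply measurableSet_Ici]
  have : Set.Ici (1 - distFun ν x) ∩ Set.Icc 0 1 = Set.Icc (1 - distFun ν x) 1 := by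
    ext β
    simp only [Set.mem_inter_iff, Set.mem_Ici, Set.mem_Icc]
    constructor
    · rintro ⟨a, b, c⟩; exact ⟨a, c⟩
    · rintro ⟨a, b⟩; exact ⟨a, by linarith, b⟩
  rw [this, Real.volume_Icc, sub_sub_cancel, distFun, ofReal_measureReal]

/-- Under the quantile transform, a value below VaR at level α can only come from a level β > α. -/
theorem measureReal_Iio_VaR_le (hα : α ∈ Set.Ioo (0 : ℝ) 1) :
    ν.real (Set.Iio (VaR α ν)) ≤ 1 - α := by
  have h : ν (Set.Iio (VaR α ν)) ≤ ENNReal.ofReal (1 - α) := by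
    conv_lhs => rw [← map_VaR ν]
    rw [Measure.map_apply_of_aemeasurable (aemeasurable_VaR ν) (by rw [map_VaR]; exact
      measurableSet_Iio), map_VaR, Measure.restrict_apply₀' measurableSet_Ioo.nullMeasurableSet,
      ← Real.volume_Ioo]
    refine measure_mono fun β hβ => ⟨?_, hβ.2.2⟩
    by_contra! hc
    exact absurd hβ.1 (not_lt.2 (antitoneOn_VaR ν hβ.2 hα hc))
  exact ENNReal.toReal_le_of_le_ofReal (by linarith [hα.2]) h

/-- The Rockafellar–Uryasev function `u ↦ u + α⁻¹ E (X - u)₊`. -/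
def ruFun (α : ℝ) (ν : Measure ℝ) (u : ℝ) : ℝ := u + α⁻¹ * ∫ x, max (x - u) 0 ∂ν

theorem integrable_excess {ν : Measure ℝ} [IsFiniteMeasure ν] (hν : Integrable (fun x => x) ν)
    (u : ℝ) : Integrable (fun x : ℝ => max (x - u) 0) ν :=
  (hν.sub (integrable_const u)).pos_part

/-- The quantile transform turns the expected excess into an integral over levels β. The excess over
VaR at level α vanishes for β ≥ α, and on (0, α] the positive part is redundant. -/
theorem ES_eq_ruFun (hα : α ∈ Set.Ioo (0 : ℝ) 1) (hν : Integrable (fun x => x) ν) :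
    ES α ν = ruFun α ν (VaR α ν) := by
  set t := VaR α ν with ht
  have hint : Integrable (fun β => max (VaR β ν - t) 0) (volume.restrict (Set.Ioo 0 1)) := by
    have h := integrable_excess hν t
    rw [← map_VaR ν] at h
    exact h.comp_aemeasurable (aemeasurable_VaR ν)
  have h1 : ∫ x, max (x - t) 0 ∂ν = ∫ β in Set.Ioo (0 : ℝ) 1, max (VaR β ν - t) 0 := by
    conv_lhs => rw [← map_VaR ν]
    rw [integral_map (aemeasurable_VaR ν)]
    exact (by fun_prop : Measurable fun x : ℝ => max (x - t) 0).aestronglyMeasurable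
  have hsub : Set.Ioc 0 α ⊆ Set.Ioo 0 1 := fun β hβ => ⟨hβ.1, hβ.2.trans_lt hα.2⟩
  have h2 : ∫ β in Set.Ioo (0 : ℝ) 1, max (VaR β ν - t) 0 =
      ∫ β in Set.Ioc (0 : ℝ) α, max (VaR β ν - t) 0 := by
    refine setIntegral_eq_of_subset_of_forall_sdiff_eq_zero measurableSet_Ioo hsub ?_
    rintro β ⟨hβ, hβ'⟩
    have : α ≤ β := by
      by_contra! hc
      exact hβ' ⟨hβ.1, hc.le⟩
    exact max_eq_right (sub_nonpos.2 (antitoneOn_VaR ν hα hβ this))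
  have h3 : ∫ β in Set.Ioc (0 : ℝ) α, VaR β ν =
      ∫ β in Set.Ioc (0 : ℝ) α, (t + max (VaR β ν - t) 0) := by
    refine setIntegral_congr_fun measurableSet_Ioc fun β hβ => ?_
    have : t ≤ VaR β ν := antitoneOn_VaR ν (hsub hβ) hα hβ.2
    rw [max_eq_left (sub_nonneg.2 this)]; ring
  rw [ES, intervalIntegral.integral_of_le hα.1.le, h3, ruFun, h1, h2,
    integral_add (integrable_const t) (hint.mono_measure (Measure.restrict_mono hsub le_rfl))]
  have hα0 : α ≠ 0 := hα.1.ne'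
  simp only [integral_const, measureReal_restrict_apply_univ, Real.volume_real_Ioc_of_le hα.1.le,
    smul_eq_mul]
  field_simp
  simp

theorem integral_indicator_const_mul {ν : Measure ℝ} {A : Set ℝ}
    (hA : MeasurableSet A) (c : ℝ) :
    ∫ x, A.indicator (fun _ => c) x ∂ν = ν.real A * c := by
  rw [integral_indicator_const _ hA, smul_eq_mul]

/-- A subgradient argument at v = VaR: the difference of excesses is at least (v - u) times the
indicator of [v, ∞) if u ≤ v, and of (v, ∞) if v ≤ u. The inequalities P(X < v) ≤ 1 - α ≤ P(X ≤ v)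
then conclude, with no continuity of the law required. -/
theorem ruFun_VaR_le (hα : α ∈ Set.Ioo (0 : ℝ) 1) (hν : Integrable (fun x => x) ν) (u : ℝ) :
    ruFun α ν (VaR α ν) ≤ ruFun α ν u := by
  set v := VaR α ν with hv
  have hi : ∫ x, max (x - u) 0 ∂ν - ∫ x, max (x - v) 0 ∂ν =
      ∫ x, (max (x - u) 0 - max (x - v) 0) ∂ν :=
    (integral_sub (integrable_excess hν u) (integrable_excess hν v)).symm
  have hii : Integrable (fun x : ℝ => max (x - u) 0 - max (x - v) 0) ν :=
    (integrable_excess hν u).sub (integrable_excess hν v)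
  suffices h : v - u ≤ α⁻¹ * (∫ x, max (x - u) 0 ∂ν - ∫ x, max (x - v) 0 ∂ν) by
    rw [ruFun, ruFun]; linarith
  rw [← div_eq_inv_mul, le_div_iff₀ hα.1, hi]
  rcases le_total u v with h | h
  · have hA : MeasurableSet (Set.Ici v) := measurableSet_Ici
    have h1 : ∫ x, (Set.Ici v).indicator (fun _ => v - u) x ∂ν ≤
        ∫ x, (max (x - u) 0 - max (x - v) 0) ∂ν := by
      refine integral_mono ((integrable_const _).indicator hA) hii fun x => ?_
      by_cases hx : v ≤ x
      · rw [Set.indicator_of_mem (Set.mem_Ici.2 hx)]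
        simp only
        rw [max_eq_left (by linarith), max_eq_left (by linarith)]; linarith
      · rw [Set.indicator_of_notMem (by simpa using hx)]
        simp only
        rw [max_eq_right (by linarith : x - v ≤ 0)]
        simp
    rw [integral_indicator_const_mul hA] at h1
    have h2 : ν.real (Set.Ici v) = 1 - ν.real (Set.Iio v) := by
      rw [← Set.compl_Iio, probReal_compl_eq_one_sub measurableSet_Iio]
    have h3 := measureReal_Iio_VaR_le (ν := ν) hα
    rw [← hv] at h3
    nlinarith
  · have hA : MeasurableSet (Set.Ioi v) := measurableSet_Ioi
    have h1 : ∫ x, (Set.Ioi v).indicator (fun _ => v - u) x ∂ν ≤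
        ∫ x, (max (x - u) 0 - max (x - v) 0) ∂ν := by
      refine integral_mono ((integrable_const _).indicator hA) hii fun x => ?_
      by_cases hx : v < x
      · rw [Set.indicator_of_mem (Set.mem_Ioi.2 hx)]
        simp only
        rw [max_eq_left (by linarith : 0 ≤ x - v)]
        linarith [le_max_left (x - u) 0]
      · rw [Set.indicator_of_notMem (by simpa using hx)]
        simp only
        rw [max_eq_right (by linarith : x - v ≤ 0)]
        simp
    rw [integral_indicator_const_mul hA] at h1
    have h2 : ν.real (Set.Ioi v) = 1 - distFun ν v := by
      rw [← Set.compl_Iic, probReal_compl_eq_one_sub measurableSet_Iic, distFun]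
    have h3 := le_distFun_VaR (ν := ν) hα
    rw [← hv] at h3
    nlinarith

/-- Quantifies the loss from using `u` in place of a minimiser: the distance to `v` times the amount
by which `u` violates the two quantile inequalities. For an empirical law with `u` the true
quantile, both factors are small. -/
theorem ruFun_sub_ruFun_le (hα : α ∈ Set.Ioo (0 : ℝ) 1) (hν : Integrable (fun x => x) ν)
    (u v : ℝ) :
    ruFun α ν u - ruFun α ν v ≤ α⁻¹ * (|v - u| *
      (max (ν.real (Set.Iio u) - (1 - α)) 0 + max (1 - α - distFun ν u) 0)) := by
  have hi : ∫ x, max (x - u) 0 ∂ν - ∫ x, max (x - v) 0 ∂ν =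
      ∫ x, (max (x - u) 0 - max (x - v) 0) ∂ν :=
    (integral_sub (integrable_excess hν u) (integrable_excess hν v)).symm
  have hii : Integrable (fun x : ℝ => max (x - u) 0 - max (x - v) 0) ν :=
    (integrable_excess hν u).sub (integrable_excess hν v)
  have e : ruFun α ν u - ruFun α ν v =
      α⁻¹ * ((u - v) * α + ∫ x, (max (x - u) 0 - max (x - v) 0) ∂ν) := by
    have := hα.1.ne'
    rw [ruFun, ruFun, ← hi]; field_simp; ring
  rw [e]
  refine mul_le_mul_of_nonneg_left ?_ (inv_nonneg.2 hα.1.le)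
  rcases le_total u v with h | h
  · have hA : MeasurableSet (Set.Ioi u) := measurableSet_Ioi
    have h1 : ∫ x, (max (x - u) 0 - max (x - v) 0) ∂ν ≤
        ∫ x, (Set.Ioi u).indicator (fun _ => v - u) x ∂ν := by
      refine integral_mono hii ((integrable_const _).indicator hA) fun x => ?_
      by_cases hx : u < x
      · rw [Set.indicator_of_mem (Set.mem_Ioi.2 hx)]
        simp only
        rw [max_eq_left (by linarith : 0 ≤ x - u)]
        linarith [le_max_left (x - v) 0]
      · rw [Set.indicator_of_notMem (by simpa using hx)]
        simp only
        rw [max_eq_right (by linarith : x - u ≤ 0)]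
        simp
    rw [integral_indicator_const_mul hA] at h1
    have h2 : ν.real (Set.Ioi u) = 1 - distFun ν u := by
      rw [← Set.compl_Iic, probReal_compl_eq_one_sub measurableSet_Iic, distFun]
    rw [h2] at h1
    rw [abs_of_nonneg (by linarith)]
    have h3 := le_max_left (1 - α - distFun ν u) 0
    have h4 := le_max_right (ν.real (Set.Iio u) - (1 - α)) 0
    nlinarith
  · have hA : MeasurableSet (Set.Ici u) := measurableSet_Ici
    have h1 : ∫ x, (max (x - u) 0 - max (x - v) 0) ∂ν ≤
        ∫ x, (Set.Ici u).indicator (fun _ => v - u) x ∂ν := by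
      refine integral_mono hii ((integrable_const _).indicator hA) fun x => ?_
      by_cases hx : u ≤ x
      · rw [Set.indicator_of_mem (Set.mem_Ici.2 hx)]
        simp only
        rw [max_eq_left (by linarith : 0 ≤ x - u)]
        linarith [le_max_left (x - v) 0]
      · rw [Set.indicator_of_notMem (by simpa using hx)]
        simp only
        rw [max_eq_right (by linarith : x - u ≤ 0)]
        simp
    rw [integral_indicator_const_mul hA] at h1
    have h2 : ν.real (Set.Ici u) = 1 - ν.real (Set.Iio u) := by
      rw [← Set.compl_Iio, probReal_compl_eq_one_sub measurableSet_Iio]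
    rw [h2] at h1
    rw [abs_of_nonpos (by linarith)]
    have h3 := le_max_left (ν.real (Set.Iio u) - (1 - α)) 0
    have h4 := le_max_right (1 - α - distFun ν u) 0
    nlinarith

end Quantile

/-! ### Empirical laws on the real line -/

/-- The empirical distribution of the first `N` terms of a real sequence. -/
def empLaw (y : ℕ → ℝ) (N : ℕ) : Measure ℝ :=
  (N : ℝ≥0∞)⁻¹ • ∑ k ∈ Finset.range N, Measure.dirac (y k)

section Empirical

theorem isProbabilityMeasure_empLaw (y : ℕ → ℝ) {N : ℕ} (hN : 0 < N) :
    IsProbabilityMeasure (empLaw y N) := by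
  constructor
  simp only [empLaw, Measure.smul_apply, Measure.coe_finsetSum, Finset.sum_apply, measure_univ,
    Finset.sum_const, Finset.card_range, smul_eq_mul, nsmul_eq_mul, mul_one]
  exact ENNReal.inv_mul_cancel (by exact_mod_cast hN.ne') (by simp)

theorem integrable_empLaw (y : ℕ → ℝ) {N : ℕ} (hN : 0 < N) (f : ℝ → ℝ) :
    Integrable f (empLaw y N) :=
  (integrable_finsetSum_measure.2 fun _ _ => integrable_dirac enorm_lt_top).smul_measure
    (by simp [hN.ne'])

theorem integral_empLaw (y : ℕ → ℝ) (N : ℕ) (f : ℝ → ℝ) :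
    ∫ x, f x ∂(empLaw y N) = (N : ℝ)⁻¹ * ∑ k ∈ Finset.range N, f (y k) := by
  rw [empLaw, integral_smul_measure,
    integral_finsetSum_measure fun _ _ => integrable_dirac enorm_lt_top]
  simp

theorem measureReal_empLaw (y : ℕ → ℝ) (N : ℕ) {A : Set ℝ} (hA : MeasurableSet A) :
    (empLaw y N).real A = (N : ℝ)⁻¹ * ∑ k ∈ Finset.range N, A.indicator (fun _ => (1 : ℝ)) (y k) := by
  rw [← integral_empLaw, integral_indicator_const_mul hA, mul_one]

theorem map_empiricalMeasure {n : ℕ} (x : ℕ → Fin n → ℝ) (N : ℕ) {π : (Fin n → ℝ) → ℝ}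
    (hπ : Measurable π) : (empiricalMeasure x N).map π = empLaw (fun k => π (x k)) N := by
  rw [empiricalMeasure, empLaw, Measure.map_smul, Measure.map_finset_sum hπ.aemeasurable]
  simp [Measure.map_dirac' hπ]

variable {Ω : Type*} [MeasurableSpace Ω] {Y : ℕ → Ω → ℝ} {α : ℝ}

theorem measurable_VaR_empLaw (hY : ∀ k, Measurable (Y k)) (hα : α ∈ Set.Ioo (0 : ℝ) 1) (N : ℕ) :
    Measurable (fun ω => VaR α (empLaw (fun k => Y k ω) N)) := by
  -- At N = 0 the empirical law is the zero measure, so the function is constant in ω.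
  rcases Nat.eq_zero_or_pos N with rfl | hN
  · simp [empLaw]
  refine measurable_of_Iic fun x => ?_
  have : (fun ω => VaR α (empLaw (fun k => Y k ω) N)) ⁻¹' Set.Iic x =
      {ω | 1 - α ≤ (N : ℝ)⁻¹ * ∑ k ∈ Finset.range N,
        (Set.Iic x).indicator (fun _ => (1 : ℝ)) (Y k ω)} := by
    ext ω
    have := isProbabilityMeasure_empLaw (fun k => Y k ω) hN
    simp only [Set.mem_preimage, Set.mem_Iic, Set.mem_ofPred_eq]
    rw [VaR_le_iff hα, distFun, measureReal_empLaw _ _ measurableSet_Iic]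
  rw [this]
  refine measurableSet_le measurable_const ?_
  refine Measurable.const_mul (Finset.measurable_sum _ fun k _ => ?_) _
  exact (measurable_const.indicator measurableSet_Iic).comp (hY k)

/-- The Rockafellar–Uryasev formula replaces the integral over levels by a finite sum of visibly
measurable terms. -/
theorem measurable_ES_empLaw (hY : ∀ k, Measurable (Y k)) (hα : α ∈ Set.Ioo (0 : ℝ) 1) (N : ℕ) :
    Measurable (fun ω => ES α (empLaw (fun k => Y k ω) N)) := by
  rcases Nat.eq_zero_or_pos N with rfl | hN
  · simp [empLaw]
  have hV := measurable_VaR_empLaw hY hα N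
  have : (fun ω => ES α (empLaw (fun k => Y k ω) N)) = fun ω =>
      VaR α (empLaw (fun k => Y k ω) N) + α⁻¹ * ((N : ℝ)⁻¹ * ∑ k ∈ Finset.range N,
        max (Y k ω - VaR α (empLaw (fun k => Y k ω) N)) 0) := by
    ext ω
    have := isProbabilityMeasure_empLaw (fun k => Y k ω) hN
    rw [ES_eq_ruFun hα (integrable_empLaw _ hN _), ruFun, integral_empLaw]
  rw [this]
  refine hV.add (Measurable.const_mul (Measurable.const_mul
    (Finset.measurable_sum _ fun k _ => ?_) _) _)
  exact ((hY k).sub hV).max measurable_const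

end Empirical

/-! ### Asymptotic linearity of empirical VaR and ES -/

section Asymptotics

variable {Ω : Type*} [MeasurableSpace Ω] {μ : Measure Ω} [IsProbabilityMeasure μ]
  {Y : ℕ → Ω → ℝ} {Y₀ : Ω → ℝ} {α : ℝ}

/-- Normalised deviation of the empirical frequency of `A` from its probability. -/
def freqDev (μ : Measure Ω) (Y : ℕ → Ω → ℝ) (Y₀ : Ω → ℝ) (A : Set ℝ) : ℕ → Ω → ℝ :=
  normSum (fun k ω => A.indicator (fun _ => (1 : ℝ)) (Y k ω))
    (∫ ω, A.indicator (fun _ => (1 : ℝ)) (Y₀ ω) ∂μ)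

theorem measurable_indicator_one {A : Set ℝ} (hA : MeasurableSet A) :
    Measurable (A.indicator fun _ : ℝ => (1 : ℝ)) := measurable_const.indicator hA

theorem memLp_indicator_comp (hY₀ : Measurable Y₀) {A : Set ℝ} (hA : MeasurableSet A) :
    MemLp (fun ω => A.indicator (fun _ => (1 : ℝ)) (Y₀ ω)) 2 μ := by
  refine MemLp.of_bound ((measurable_indicator_one hA).comp hY₀).aestronglyMeasurable 1
    (ae_of_all _ fun ω => ?_)
  by_cases h : Y₀ ω ∈ A <;> simp [h]

theorem integral_indicator_comp (hY₀ : Measurable Y₀) {A : Set ℝ} (hA : MeasurableSet A) :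
    ∫ ω, A.indicator (fun _ => (1 : ℝ)) (Y₀ ω) ∂μ = (μ.map Y₀).real A := by
  rw [← integral_map (f := A.indicator fun _ => (1 : ℝ)) hY₀.aemeasurable
    (measurable_indicator_one hA).aestronglyMeasurable, integral_indicator_const_mul hA, mul_one]

theorem sqrt_mul_empLaw_sub (hY₀ : Measurable Y₀) {A : Set ℝ} (hA : MeasurableSet A) {N : ℕ}
    (hN : 0 < N) (ω : Ω) :
    √(N : ℝ) * ((empLaw (fun k => Y k ω) N).real A - (μ.map Y₀).real A) =
      freqDev μ Y Y₀ A N ω := by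
  rw [measureReal_empLaw _ _ hA, freqDev, ← sqrt_mul_mean_sub hN, integral_indicator_comp hY₀ hA]

theorem iIndepFun_comp_const (hindep : iIndepFun Y μ) {φ : ℝ → ℝ} (hφ : Measurable φ) :
    iIndepFun (fun k ω => φ (Y k ω)) μ :=
  hindep.comp (fun _ => φ) fun _ => hφ

theorem bigOP_freqDev (hY₀ : Measurable Y₀) (hindep : iIndepFun Y μ)
    (hident : ∀ k, IdentDistrib (Y k) Y₀ μ μ) {A : Set ℝ} (hA : MeasurableSet A) :
    BigOP μ (freqDev μ Y Y₀ A) :=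
  bigOP_normSum (memLp_indicator_comp hY₀ hA)
    (iIndepFun_comp_const hindep (measurable_indicator_one hA))
    (fun k => (hident k).comp (measurable_indicator_one hA))

theorem smallOP_empLaw_sub (hY₀ : Measurable Y₀) (hindep : iIndepFun Y μ)
    (hident : ∀ k, IdentDistrib (Y k) Y₀ μ μ) {A : Set ℝ} (hA : MeasurableSet A) :
    SmallOP μ (fun N ω => (empLaw (fun k => Y k ω) N).real A - (μ.map Y₀).real A) := by
  refine .of_sqrt_mul ((bigOP_freqDev hY₀ hindep hident hA).of_le ?_)
  filter_upwards [eventually_gt_atTop 0] with N hN ω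
  rw [sqrt_mul_empLaw_sub hY₀ hA hN]

/-- Chebyshev's inequality for the difference of two half-line indicators. Its square is plus or
minus itself, so its variance is at most the increment of the distribution function. This controls
the empirical process near the quantile. -/
theorem measureReal_freqDev_sub_le (hY₀ : Measurable Y₀) (hindep : iIndepFun Y μ)
    (hident : ∀ k, IdentDistrib (Y k) Y₀ μ μ) (x t : ℝ) {N : ℕ} (hN : 0 < N) {ε : ℝ}
    (hε : 0 < ε) :
    μ.real {ω | ε ≤ |freqDev μ Y Y₀ (Set.Iic x) N ω - freqDev μ Y Y₀ (Set.Iic t) N ω|} ≤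
      |distFun (μ.map Y₀) x - distFun (μ.map Y₀) t| / ε ^ 2 := by
  set φ : ℝ → ℝ := fun z => (Set.Iic x).indicator (fun _ => (1 : ℝ)) z -
    (Set.Iic t).indicator (fun _ => (1 : ℝ)) z with hφ
  have hφm : Measurable φ := (measurable_indicator_one measurableSet_Iic).sub
    (measurable_indicator_one measurableSet_Iic)
  have hx := memLp_indicator_comp (μ := μ) hY₀ (measurableSet_Iic (a := x))
  have ht := memLp_indicator_comp (μ := μ) hY₀ (measurableSet_Iic (a := t))
  have hL : MemLp (fun ω => φ (Y₀ ω)) 2 μ := hx.sub ht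
  have hint : ∫ ω, φ (Y₀ ω) ∂μ = distFun (μ.map Y₀) x - distFun (μ.map Y₀) t := by
    rw [integral_sub (hx.integrable one_le_two) (ht.integrable one_le_two),
      integral_indicator_comp hY₀ measurableSet_Iic, integral_indicator_comp hY₀ measurableSet_Iic]
    rfl
  have hcheb := measureReal_le_normSum hL (iIndepFun_comp_const hindep hφm)
    (fun k => (hident k).comp hφm) hN hε
  have hset : ∀ ω, normSum (fun k ω => φ (Y k ω)) (∫ ω, φ (Y₀ ω) ∂μ) N ω =
      freqDev μ Y Y₀ (Set.Iic x) N ω - freqDev μ Y Y₀ (Set.Iic t) N ω := by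
    intro ω
    rw [hint, freqDev, freqDev, integral_indicator_comp hY₀ measurableSet_Iic,
      integral_indicator_comp hY₀ measurableSet_Iic]
    simp only [normSum, hφ, Finset.sum_sub_distrib, distFun]
    ring
  simp only [hset] at hcheb
  refine hcheb.trans (div_le_div_of_nonneg_right ?_ (by positivity))
  refine (variance_le_expectation_sq hL.aestronglyMeasurable).trans ?_
  rcases le_total x t with h | h
  · have : ∀ ω, ((fun ω => φ (Y₀ ω)) ^ 2) ω = -φ (Y₀ ω) := by
      intro ω
      simp only [Pi.pow_apply, hφ]
      by_cases h1 : Y₀ ω ≤ x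
      · simp [h1, h1.trans h]
      · by_cases h2 : Y₀ ω ≤ t <;> simp [h1, h2]
    simp only [this]
    rw [integral_neg, hint]
    exact neg_le_abs _
  · have : ∀ ω, ((fun ω => φ (Y₀ ω)) ^ 2) ω = φ (Y₀ ω) := by
      intro ω
      simp only [Pi.pow_apply, hφ]
      by_cases h1 : Y₀ ω ≤ t
      · simp [h1, h1.trans h]
      · by_cases h2 : Y₀ ω ≤ x <;> simp [h1, h2]
    simp only [this]
    rw [hint]
    exact le_abs_self _

theorem distFun_VaR_eq {ν : Measure ℝ} [IsProbabilityMeasure ν] (hα : α ∈ Set.Ioo (0 : ℝ) 1)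
    (hc : ContinuousAt (distFun ν) (VaR α ν)) : distFun ν (VaR α ν) = 1 - α := by
  refine le_antisymm ?_ (le_distFun_VaR hα)
  refine le_of_tendsto (hc.tendsto.mono_left (nhdsWithin_le_nhds (s := Set.Iio (VaR α ν)))) ?_
  filter_upwards [self_mem_nhdsWithin] with x hx
  exact ((lt_VaR_iff hα).1 hx).le

/-- Bahadur's representation of the empirical quantile. -/
theorem smallOP_VaR_empLaw (hY₀ : Measurable Y₀) (hindep : iIndepFun Y μ)
    (hident : ∀ k, IdentDistrib (Y k) Y₀ μ μ) (hα : α ∈ Set.Ioo (0 : ℝ) 1)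
    (hd : HasPositiveDensityAt (μ.map Y₀) (VaR α (μ.map Y₀))) :
    SmallOP μ (fun N ω => √(N : ℝ) * (VaR α (empLaw (fun k => Y k ω) N) - VaR α (μ.map Y₀)) -
      (-1 / densityAt (μ.map Y₀) (VaR α (μ.map Y₀))) *
        freqDev μ Y Y₀ (Set.Iic (VaR α (μ.map Y₀))) N ω) := by
  have hprob : IsProbabilityMeasure (μ.map Y₀) := Measure.isProbabilityMeasure_map hY₀.aemeasurable
  set ν := μ.map Y₀ with hν
  set t := VaR α ν with ht
  set d := densityAt ν t with hd_def
  have hd0 : 0 < d := hd.2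
  have hFt : distFun ν t = 1 - α := distFun_VaR_eq hα hd.1.continuousAt
  have hderiv : HasDerivAt (distFun ν) d t := hd.1.hasDerivAt
  have hsq : Tendsto (fun N : ℕ => √(N : ℝ)) atTop atTop :=
    Real.tendsto_sqrt_atTop.comp tendsto_natCast_atTop_atTop
  have hrem : ∀ y, Tendsto (fun N : ℕ => √(N : ℝ) *
      (distFun ν (t + y / √(N : ℝ)) - distFun ν t)) atTop (𝓝 (d * y)) := by
    intro y
    have h := (hderiv.hasFDerivAt.lim_real y).comp hsq
    simpa [Function.comp_def, div_eq_inv_mul, mul_comm] using h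
  have hD : ∀ y, SmallOP μ (fun N ω => freqDev μ Y Y₀ (Set.Iic (t + y / √(N : ℝ))) N ω -
      freqDev μ Y Y₀ (Set.Iic t) N ω) := by
    intro y ε hε
    have h1 : Tendsto (fun N : ℕ => t + y / √(N : ℝ)) atTop (𝓝 t) := by
      simpa using tendsto_const_nhds.add (tendsto_const_nhds.div_atTop hsq)
    have h2 : Tendsto (fun N : ℕ => |distFun ν (t + y / √(N : ℝ)) - distFun ν t| / ε ^ 2)
        atTop (𝓝 0) := by
      have := ((hd.1.continuousAt.tendsto.comp h1).sub_const (distFun ν t)).abs.div_const (ε ^ 2)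
      simpa using this
    refine tendsto_of_tendsto_of_tendsto_of_le_of_le' tendsto_const_nhds h2
      (Eventually.of_forall fun _ => measureReal_nonneg) ?_
    filter_upwards [eventually_gt_atTop 0] with N hN
    exact measureReal_freqDev_sub_le hY₀ hindep hident _ _ hN hε
  -- The rescaled empirical distribution function at t + y/√N splits into a local increment
  -- vanishing in probability, the deviation at t, and a drift tending to d y.
  have hexp : ∀ (y : ℝ) {N : ℕ}, 0 < N → ∀ ω,
      √(N : ℝ) * (distFun (empLaw (fun k => Y k ω) N) (t + y / √(N : ℝ)) - (1 - α)) =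
      (freqDev μ Y Y₀ (Set.Iic (t + y / √(N : ℝ))) N ω - freqDev μ Y Y₀ (Set.Iic t) N ω) +
        freqDev μ Y Y₀ (Set.Iic t) N ω + √(N : ℝ) * (distFun ν (t + y / √(N : ℝ)) - distFun ν t) := by
    intro y N hN ω
    rw [← sqrt_mul_empLaw_sub hY₀ measurableSet_Iic hN, ← hν, ← hFt]
    simp only [distFun]
    ring
  refine SmallOP.sub_of_comparison ((bigOP_freqDev hY₀ hindep hident measurableSet_Iic).const_mul _)
    ?_ ?_
  · intro y ε hε
    -- On this event the left side of `hexp` is nonnegative, while the deviation at t is at most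
    -- -d(y + ε) and the drift is below d y + d ε/2. The increment must therefore be at least d ε/2.
    have hde : 0 < d * ε / 2 := by positivity
    refine tendsto_measureReal_of_le (hD y (d * ε / 2) hde) ?_
    filter_upwards [eventually_gt_atTop (0 : ℕ), (hrem y).eventually_lt_const (by linarith :
      d * y < d * y + d * ε / 2)] with N hN hr ω hω
    obtain ⟨h1, h2⟩ := hω
    have hN' : (0 : ℝ) < √N := by positivity
    have := isProbabilityMeasure_empLaw (fun k => Y k ω) hN
    have h3 : VaR α (empLaw (fun k => Y k ω) N) ≤ t + y / √N := by
      rw [← sub_le_iff_le_add', le_div_iff₀' hN']; exact h1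
    rw [VaR_le_iff hα] at h3
    have h4 := mul_nonneg hN'.le (sub_nonneg.2 h3)
    rw [hexp y hN ω] at h4
    rw [div_mul_eq_mul_div, le_div_iff₀ hd0] at h2
    rw [Set.mem_ofPred_eq]
    refine le_trans ?_ (le_abs_self _)
    nlinarith
  · intro y ε hε
    -- Testing at the midpoint y + ε/2 makes the quantile inequality strict. Half of the margin d
    -- ε/2 absorbs the error in the drift, and d ε/4 is left for the increment.
    have hde : 0 < d * ε / 4 := by positivity
    refine tendsto_measureReal_of_le (hD (y + ε / 2) (d * ε / 4) hde) ?_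
    filter_upwards [eventually_gt_atTop (0 : ℕ), (hrem (y + ε / 2)).eventually_const_lt (by linarith :
      d * (y + ε / 2) - d * ε / 4 < d * (y + ε / 2))] with N hN hr ω hω
    obtain ⟨h1, h2⟩ := hω
    have hN' : (0 : ℝ) < √N := by positivity
    have := isProbabilityMeasure_empLaw (fun k => Y k ω) hN
    have h3 : t + (y + ε / 2) / √N < VaR α (empLaw (fun k => Y k ω) N) := by
      rw [← lt_sub_iff_add_lt', div_lt_iff₀' hN']; linarith
    rw [lt_VaR_iff hα] at h3
    have h4 := mul_pos hN' (sub_pos.2 h3)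
    have h5 := hexp (y + ε / 2) hN ω
    rw [div_mul_eq_mul_div, div_le_iff₀ hd0] at h2
    rw [Set.mem_ofPred_eq]
    refine le_trans ?_ (neg_le_abs _)
    nlinarith

/-- The empirical quantile is consistent when the quantile is unique. -/
theorem smallOP_VaR_empLaw_sub (hY₀ : Measurable Y₀) (hindep : iIndepFun Y μ)
    (hident : ∀ k, IdentDistrib (Y k) Y₀ μ μ) (hα : α ∈ Set.Ioo (0 : ℝ) 1)
    (huniq : ∀ x > VaR α (μ.map Y₀), 1 - α < distFun (μ.map Y₀) x) :
    SmallOP μ (fun N ω => VaR α (empLaw (fun k => Y k ω) N) - VaR α (μ.map Y₀)) := by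
  have hprob : IsProbabilityMeasure (μ.map Y₀) := Measure.isProbabilityMeasure_map hY₀.aemeasurable
  set ν := μ.map Y₀ with hν
  set t := VaR α ν with ht
  intro ε hε
  have h1 : 0 < distFun ν (t + ε / 2) - (1 - α) := sub_pos.2 (huniq _ (by linarith))
  have h2 : 0 < (1 - α) - distFun ν (t - ε) := sub_pos.2 ((lt_VaR_iff hα).1 (by linarith))
  refine tendsto_measureReal_of_le (tendsto_measureReal_union
    (smallOP_empLaw_sub hY₀ hindep hident (measurableSet_Iic (a := t + ε / 2)) _ h1)
    (smallOP_empLaw_sub hY₀ hindep hident (measurableSet_Iic (a := t - ε)) _ h2)) ?_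
  filter_upwards [eventually_gt_atTop 0] with N hN ω hω
  have := isProbabilityMeasure_empLaw (fun k => Y k ω) hN
  rw [Set.mem_ofPred_eq] at hω
  rcases le_abs.1 hω with h | h
  · left
    have h3 : t + ε / 2 < VaR α (empLaw (fun k => Y k ω) N) := by linarith
    rw [lt_VaR_iff hα] at h3
    rw [Set.mem_ofPred_eq]
    refine le_trans ?_ (neg_le_abs _)
    simp only [distFun] at h3 ⊢
    linarith
  · right
    have h3 : VaR α (empLaw (fun k => Y k ω) N) ≤ t - ε := by linarith
    rw [VaR_le_iff hα] at h3
    rw [Set.mem_ofPred_eq]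
    refine le_trans ?_ (le_abs_self _)
    simp only [distFun] at h3 ⊢
    linarith

theorem integral_excess_comp (hY₀ : Measurable Y₀) (t : ℝ) :
    ∫ ω, max (Y₀ ω - t) 0 ∂μ = ∫ x, max (x - t) 0 ∂(μ.map Y₀) := by
  rw [integral_map hY₀.aemeasurable]
  exact (by fun_prop : Measurable fun x : ℝ => max (x - t) 0).aestronglyMeasurable

/-- Asymptotic linearity of the empirical Expected Shortfall. -/
theorem smallOP_ES_empLaw (hY₀ : Measurable Y₀) (hint : Integrable Y₀ μ) (hindep : iIndepFun Y μ)
    (hident : ∀ k, IdentDistrib (Y k) Y₀ μ μ) (hα : α ∈ Set.Ioo (0 : ℝ) 1)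
    (huniq : ∀ x > VaR α (μ.map Y₀), 1 - α < distFun (μ.map Y₀) x) :
    SmallOP μ (fun N ω => √(N : ℝ) * (ES α (empLaw (fun k => Y k ω) N) - ES α (μ.map Y₀)) -
      α⁻¹ * normSum (fun k ω => max (Y k ω - VaR α (μ.map Y₀)) 0)
        (∫ ω, max (Y₀ ω - VaR α (μ.map Y₀)) 0 ∂μ) N ω) := by
  have hprob : IsProbabilityMeasure (μ.map Y₀) := Measure.isProbabilityMeasure_map hY₀.aemeasurable
  have hcons := smallOP_VaR_empLaw_sub hY₀ hindep hident hα huniq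
  have hid : Integrable (fun x : ℝ => x) (μ.map Y₀) :=
    (integrable_map_measure measurable_id.aestronglyMeasurable hY₀.aemeasurable).2 hint
  have hle := bigOP_freqDev hY₀ hindep hident (measurableSet_Iic (a := VaR α (μ.map Y₀)))
  have hlt := bigOP_freqDev hY₀ hindep hident (measurableSet_Iio (a := VaR α (μ.map Y₀)))
  set ν := μ.map Y₀ with hν
  set t := VaR α ν with ht
  have habs : BigOP μ (fun N ω => |freqDev μ Y Y₀ (Set.Iio t) N ω| +
      |freqDev μ Y Y₀ (Set.Iic t) N ω|) :=
    (hlt.of_le (Eventually.of_forall fun _ _ => (abs_abs _).le)).add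
      (hle.of_le (Eventually.of_forall fun _ _ => (abs_abs _).le))
  refine ((hcons.mul_bigOP habs).const_mul α⁻¹).of_le ?_
  filter_upwards [eventually_gt_atTop 0] with N hN ω
  have hp := isProbabilityMeasure_empLaw (fun k => Y k ω) hN
  set νN := empLaw (fun k => Y k ω) N with hνN
  have hiN : Integrable (fun x : ℝ => x) νN := integrable_empLaw _ hN _
  have hN' : (0 : ℝ) < √N := by positivity
  rw [ES_eq_ruFun hα hid, ES_eq_ruFun hα hiN, ← sqrt_mul_mean_sub hN, integral_excess_comp hY₀,
    ← integral_empLaw (fun k => Y k ω) N (fun x => max (x - t) 0), ← hνN, ← hν, ← ht]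
  -- The linearisation error is exactly minus √N times the suboptimality of the true quantile t for
  -- the empirical `ruFun`.
  have e : √(N : ℝ) * (ruFun α νN (VaR α νN) - ruFun α ν t) -
      α⁻¹ * (√(N : ℝ) * (∫ x, max (x - t) 0 ∂νN - ∫ x, max (x - t) 0 ∂ν)) =
      -(√(N : ℝ) * (ruFun α νN t - ruFun α νN (VaR α νN))) := by
    simp only [ruFun]; ring
  have h0 := ruFun_VaR_le (ν := νN) hα hiN t
  rw [e, abs_neg, abs_of_nonneg (mul_nonneg hN'.le (sub_nonneg.2 h0)), abs_mul α⁻¹,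
    abs_mul (VaR α νN - t), abs_of_pos (inv_pos.2 hα.1), abs_of_nonneg (a := |_| + |_|)
      (add_nonneg (abs_nonneg _) (abs_nonneg _))]
  refine (mul_le_mul_of_nonneg_left (ruFun_sub_ruFun_le (ν := νN) hα hiN t (VaR α νN))
    hN'.le).trans ?_
  rw [← sqrt_mul_empLaw_sub hY₀ measurableSet_Iio hN, ← sqrt_mul_empLaw_sub hY₀ measurableSet_Iic hN,
    abs_mul √(N : ℝ), abs_mul √(N : ℝ), abs_of_pos hN', ← mul_add]
  -- Since the true law satisfies both quantile inequalities at t, the empirical violations are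
  -- bounded by empirical deviations. Treating `Iio` and `Iic` separately allows an atom at t.
  have h1 : max (νN.real (Set.Iio t) - (1 - α)) 0 ≤ |νN.real (Set.Iio t) - ν.real (Set.Iio t)| := by
    refine max_le (le_trans ?_ (le_abs_self _)) (abs_nonneg _)
    have := measureReal_Iio_VaR_le (ν := ν) hα
    rw [← ht] at this
    linarith
  have h2 : max (1 - α - distFun νN t) 0 ≤ |νN.real (Set.Iic t) - ν.real (Set.Iic t)| := by
    refine max_le (le_trans ?_ (neg_le_abs _)) (abs_nonneg _)
    have := le_distFun_VaR (ν := ν) hα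
    rw [← ht] at this
    simp only [distFun] at this ⊢
    linarith
  have h3 : 0 ≤ α⁻¹ := (inv_pos.2 hα.1).le
  calc √(N : ℝ) * (α⁻¹ * (|VaR α νN - t| * (max (νN.real (Set.Iio t) - (1 - α)) 0 +
        max (1 - α - distFun νN t) 0)))
      ≤ √(N : ℝ) * (α⁻¹ * (|VaR α νN - t| * (|νN.real (Set.Iio t) - ν.real (Set.Iio t)| +
        |νN.real (Set.Iic t) - ν.real (Set.Iic t)|))) := by gcongr
    _ = _ := by ring

end Asymptotics

/-! ### The linearised ratio: central limit theorem and variance blow-up -/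

section Ratio

variable {Ω : Type*} [MeasurableSpace Ω] {μ : Measure Ω} [IsProbabilityMeasure μ] {n : ℕ}
  {X : Ω → Fin n → ℝ} {Xs : ℕ → Ω → Fin n → ℝ} {α : ℝ}

/-- The variance of the linearisation at `(a, b)` of a quotient whose numerator and denominator
fluctuate like `B` and `A`. -/
def ratioVar (μ : Measure Ω) (a b : ℝ) (A B : Ω → ℝ) : ℝ :=
  variance (fun ω => -(a / b ^ 2) * A ω + 1 / b * B ω) μ

theorem dotProduct_covMat_mulVec {m : ℕ} {V : Ω → Fin m → ℝ} (hV : ∀ i, MemLp (fun ω => V ω i) 2 μ)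
    (w : Fin m → ℝ) :
    w ⬝ᵥ (covMat μ V *ᵥ w) = variance (fun ω => ∑ i, w i * V ω i) μ := by
  rw [variance_fun_sum fun i => (hV i).const_mul (w i)]
  simp only [dotProduct, Matrix.mulVec, covMat, Matrix.of_apply, Finset.mul_sum]
  refine Finset.sum_congr rfl fun i _ => Finset.sum_congr rfl fun j _ => ?_
  rw [covariance_const_mul_left, covariance_const_mul_right]
  ring

theorem empDR_eq (φ : Measure ℝ → ℝ) (x : ℕ → Fin n → ℝ) (N : ℕ) :
    empDR φ x N = φ (empLaw (fun k => ∑ i, x k i) N) / ∑ i, φ (empLaw (fun k => x k i) N) := by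
  rw [empDR, DR, sumLaw, map_empiricalMeasure x N (π := fun y => ∑ i, y i) (by fun_prop)]
  congr 1
  refine Finset.sum_congr rfl fun i _ => ?_
  rw [margLaw, map_empiricalMeasure x N (π := fun y => y i) (by fun_prop)]

theorem normSum_linear {ι : Type*} (s : Finset ι) (η : ι → ℕ → Ω → ℝ) (m c : ι → ℝ)
    (N : ℕ) (ω : Ω) :
    normSum (fun k ω => ∑ i ∈ s, c i * η i k ω) (∑ i ∈ s, c i * m i) N ω =
      ∑ i ∈ s, c i * normSum (η i) (m i) N ω := by
  simp only [normSum, Finset.mul_sum]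
  rw [Finset.sum_comm, ← Finset.sum_sub_distrib, Finset.mul_sum]
  refine Finset.sum_congr rfl fun i _ => ?_
  rw [← Finset.mul_sum]
  ring

theorem normSum_add (η η' : ℕ → Ω → ℝ) (m m' c c' : ℝ) (N : ℕ) (ω : Ω) :
    normSum (fun k ω => c * η k ω + c' * η' k ω) (c * m + c' * m') N ω =
      c * normSum η m N ω + c' * normSum η' m' N ω := by
  simp only [normSum, Finset.sum_add_distrib, ← Finset.mul_sum]
  ring

/-- Asymptotic normality of the empirical diversification ratio of a risk measure whose empirical
versions are asymptotically linear. -/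
theorem tendstoInDistribution_empDR (φ : Measure ℝ → ℝ)
    (hindep : iIndepFun Xs μ) (hident : ∀ k, IdentDistrib (Xs k) X μ μ)
    {ψ : Fin n → ℝ → ℝ} {ψS : ℝ → ℝ} (hψ : ∀ i, Measurable (ψ i)) (hψS : Measurable ψS)
    (hL : ∀ i, MemLp (fun ω => ψ i (X ω i)) 2 μ) (hLS : MemLp (fun ω => ψS (∑ i, X ω i)) 2 μ)
    (c : Fin n → ℝ) (cS : ℝ)
    (hm : ∀ i N, Measurable (fun ω => φ (empLaw (fun k => Xs k ω i) N)))
    (hmS : ∀ N, Measurable (fun ω => φ (empLaw (fun k => ∑ i, Xs k ω i) N)))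
    (h : ∀ i, SmallOP μ (fun N ω => √(N : ℝ) * (φ (empLaw (fun k => Xs k ω i) N) -
      φ (margLaw μ X i)) - c i * normSum (fun k ω => ψ i (Xs k ω i)) (∫ ω, ψ i (X ω i) ∂μ) N ω))
    (hS : SmallOP μ (fun N ω => √(N : ℝ) * (φ (empLaw (fun k => ∑ i, Xs k ω i) N) -
      φ (sumLaw μ X)) - cS * normSum (fun k ω => ψS (∑ i, Xs k ω i))
        (∫ ω, ψS (∑ i, X ω i) ∂μ) N ω))
    (h0 : ∑ i, φ (margLaw μ X i) ≠ 0) :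
    TendstoInDistribution
      (fun (N : ℕ) ω => √(N : ℝ) * (empDR φ (fun k => Xs k ω) N - DR φ μ X))
      atTop (id : ℝ → ℝ) (fun _ => μ)
      (gaussianReal 0 (ratioVar μ (φ (sumLaw μ X)) (∑ i, φ (margLaw μ X i))
        (fun ω => ∑ i, c i * ψ i (X ω i)) (fun ω => cS * ψS (∑ i, X ω i))).toNNReal) := by
  set a := φ (sumLaw μ X) with ha
  set b := ∑ i, φ (margLaw μ X i) with hb
  have hev : ∀ i : Fin n, Measurable fun y : Fin n → ℝ => ψ i (y i) := fun i =>
    (hψ i).comp (measurable_pi_apply i)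
  have hevS : Measurable fun y : Fin n → ℝ => ψS (∑ i, y i) := hψS.comp (by fun_prop)
  have hU : BigOP μ (normSum (fun k ω => ψS (∑ i, Xs k ω i)) (∫ ω, ψS (∑ i, X ω i) ∂μ)) :=
    bigOP_normSum hLS (hindep.comp (fun _ y => ψS (∑ i, y i)) fun _ => hevS)
      fun k => (hident k).comp hevS
  have hV : ∀ i, BigOP μ (normSum (fun k ω => ψ i (Xs k ω i)) (∫ ω, ψ i (X ω i) ∂μ)) := fun i =>
    bigOP_normSum (hL i) (hindep.comp (fun _ y => ψ i (y i)) fun _ => hev i)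
      fun k => (hident k).comp (hev i)
  have hB : SmallOP μ (fun N ω => √(N : ℝ) * (∑ i, φ (empLaw (fun k => Xs k ω i) N) - b) -
      ∑ i, c i * normSum (fun k ω => ψ i (Xs k ω i)) (∫ ω, ψ i (X ω i) ∂μ) N ω) := by
    refine (SmallOP.sum Finset.univ fun i _ => h i).congr (Eventually.of_forall fun N ω => ?_)
    rw [Finset.sum_sub_distrib, ← Finset.mul_sum, Finset.sum_sub_distrib]
  have hmain := SmallOP.div_sub_div h0 (hU.const_mul cS)
    (BigOP.sum Finset.univ fun i _ => (hV i).const_mul (c i)) hS hB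
  -- Influence function of the ratio. Everything depends on the sample through the i.i.d. scalars
  -- Ψ(X_k).
  set Ψ : (Fin n → ℝ) → ℝ := fun y => -(a / b ^ 2) * (∑ i, c i * ψ i (y i)) +
    1 / b * (cS * ψS (∑ i, y i)) with hΨ
  have hΨm : Measurable Ψ := by
    refine ((Finset.measurable_sum _ fun i _ => (hev i).const_mul (c i)).const_mul _).add ?_
    exact (hevS.const_mul cS).const_mul _
  have hLA : MemLp (fun ω => ∑ i, c i * ψ i (X ω i)) 2 μ :=
    memLp_finsetSum _ fun i _ => (hL i).const_mul (c i)
  have hLΨ : MemLp (fun ω => Ψ (X ω)) 2 μ :=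
    (hLA.const_mul _).add ((hLS.const_mul cS).const_mul _)
  refine tendstoInDistribution_of_smallOP_sub_normSum (η := fun k ω => Ψ (Xs k ω)) hLΨ
    (hindep.comp (fun _ => Ψ) fun _ => hΨm) (fun k => (hident k).comp hΨm) (fun N => ?_) ?_
  · simp only [empDR_eq]
    exact (((hmS N).div (Finset.measurable_sum _ fun i _ => hm i N)).sub_const _).const_mul _
      |>.aemeasurable
  · have hmean : ∫ ω, Ψ (X ω) ∂μ = -(a / b ^ 2) * (∑ i, c i * ∫ ω, ψ i (X ω i) ∂μ) +
        1 / b * (cS * ∫ ω, ψS (∑ i, X ω i) ∂μ) := by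
      rw [integral_add ((hLA.integrable one_le_two).const_mul _)
        (((hLS.integrable one_le_two).const_mul cS).const_mul _), integral_const_mul,
        integral_const_mul, integral_const_mul,
        integral_finsetSum _ fun i _ => ((hL i).integrable one_le_two).const_mul (c i)]
      simp only [integral_const_mul]
    refine hmain.congr (Eventually.of_forall fun N ω => ?_)
    have e1 := normSum_add (fun k ω => ∑ i, c i * ψ i (Xs k ω i))
      (fun k ω => ψS (∑ i, Xs k ω i)) (∑ i, c i * ∫ ω, ψ i (X ω i) ∂μ)
      (∫ ω, ψS (∑ i, X ω i) ∂μ) (-(a / b ^ 2)) (1 / b * cS) N ω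
    rw [normSum_linear Finset.univ (fun i k ω => ψ i (Xs k ω i))] at e1
    rw [empDR_eq, DR, ← ha, ← hb, hmean]
    simp only [hΨ, ← mul_assoc (1 / b)]
    rw [e1]
    ring

theorem ratioVar_eq {A B : Ω → ℝ} (hA : MemLp A 2 μ) (hB : MemLp B 2 μ) {a b : ℝ} (hb : b ≠ 0) :
    ratioVar μ a b A B = (a ^ 2 * variance A μ - 2 * a * b * covariance A B μ +
      b ^ 2 * variance B μ) / b ^ 4 := by
  rw [ratioVar, variance_fun_add (hA.const_mul _) (hB.const_mul _), variance_const_mul,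
    variance_const_mul, covariance_const_mul_left, covariance_const_mul_right]
  field_simp
  ring

/-- The variance of the linearised quotient explodes as the denominator vanishes while the
difference of numerator and denominator stays fixed. -/
theorem tendsto_ratioVar_atTop {A B : Ω → ℝ} (hA : MemLp A 2 μ) (hB : MemLp B 2 μ) {d : ℝ}
    (h₁ : d ≠ 0 → variance A μ ≠ 0 ∨ variance B μ ≠ 0)
    (h₂ : d = 0 → variance A μ - 2 * covariance A B μ + variance B μ ≠ 0) :
    Tendsto (fun τ => ratioVar μ (d + τ) τ A B) (𝓝[≠] 0) atTop := by
  have hVA := variance_nonneg A μ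
  have hVB := variance_nonneg B μ
  have hsub : 0 ≤ variance A μ - 2 * covariance A B μ + variance B μ := by
    rw [← variance_sub hA hB]; exact variance_nonneg _ _
  have hpow : ∀ m : ℕ, m ≠ 0 → Even m → Tendsto (fun τ : ℝ => (τ ^ m)⁻¹) (𝓝[≠] 0) atTop := by
    intro m hm he
    refine Tendsto.inv_tendsto_nhdsGT_zero ?_
    refine tendsto_nhdsWithin_iff.2 ⟨?_, ?_⟩
    · have : Tendsto (fun τ : ℝ => τ ^ m) (𝓝 0) (𝓝 (0 ^ m)) := (continuous_pow m).tendsto 0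
      rw [zero_pow hm] at this
      exact this.mono_left nhdsWithin_le_nhds
    · filter_upwards [self_mem_nhdsWithin] with τ hτ using he.pow_pos hτ
  -- With d = 0 the ratio is 1 for every τ, and the quadratic form collapses to Var(B - A)/τ².
  rcases eq_or_ne d 0 with rfl | hd
  · have hK := lt_of_le_of_ne hsub (h₂ rfl).symm
    refine ((hpow 2 two_ne_zero even_two).const_mul_atTop hK).congr' ?_
    filter_upwards [self_mem_nhdsWithin] with τ hτ
    have hτ' : τ ≠ 0 := hτ
    rw [ratioVar_eq hA hB hτ', zero_add]
    field_simp
  rcases eq_or_ne (variance A μ) 0 with h | h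
  -- If A is degenerate, Var(xA + B) is affine in x and nonnegative, so its slope is zero. The
  -- witness below would give it the value -1.
  · have hcov : covariance A B μ = 0 := by
      have hq : ∀ x : ℝ, 0 ≤ variance B μ + 2 * x * covariance A B μ := by
        intro x
        have := variance_nonneg (fun ω => x * A ω + B ω) μ
        rw [variance_fun_add (hA.const_mul x) hB, variance_const_mul, covariance_const_mul_left,
          h] at this
        linarith
      by_contra hne
      have := hq (-(variance B μ + 1) / (2 * covariance A B μ))
      field_simp at this
      linarith
    have hB0 : 0 < variance B μ := lt_of_le_of_ne hVB ((h₁ hd).resolve_left (not_not.2 h)).symm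
    refine ((hpow 2 two_ne_zero even_two).const_mul_atTop hB0).congr' ?_
    filter_upwards [self_mem_nhdsWithin] with τ hτ
    have hτ' : τ ≠ 0 := hτ
    rw [ratioVar_eq hA hB hτ', h, hcov]
    field_simp
    ring
  -- The numerator tends to d² Var(A) > 0 over τ⁴.
  · have hA0 : 0 < variance A μ := lt_of_le_of_ne hVA h.symm
    have hlim : Tendsto (fun τ : ℝ => (d + τ) ^ 2 * variance A μ -
        2 * (d + τ) * τ * covariance A B μ + τ ^ 2 * variance B μ) (𝓝[≠] 0)
        (𝓝 (d ^ 2 * variance A μ)) := by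
      have hc : Continuous fun τ : ℝ => (d + τ) ^ 2 * variance A μ -
        2 * (d + τ) * τ * covariance A B μ + τ ^ 2 * variance B μ := by fun_prop
      have := (hc.tendsto 0).mono_left (nhdsWithin_le_nhds (s := {0}ᶜ))
      simpa using this
    refine ((hlim.pos_mul_atTop (by positivity) (hpow 4 (by norm_num) (by decide)))).congr' ?_
    filter_upwards [self_mem_nhdsWithin] with τ hτ
    rw [ratioVar_eq hA hB hτ, div_eq_mul_inv]

end Ratio

/-! ### Behaviour under translation -/

section Shift

variable {ν : Measure ℝ} {α : ℝ}

theorem distFun_map_add_const (ν : Measure ℝ) (c x : ℝ) :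
    distFun (ν.map (· + c)) x = distFun ν (x - c) := by
  rw [distFun, map_measureReal_apply (by fun_prop) measurableSet_Iic, distFun]
  congr 1
  ext z
  simp [le_sub_iff_add_le]

theorem VaR_map_add_const [IsProbabilityMeasure ν] (hα : α ∈ Set.Ioo (0 : ℝ) 1) (c : ℝ) :
    VaR α (ν.map (· + c)) = VaR α ν + c := by
  have : IsProbabilityMeasure (ν.map (· + c)) :=
    Measure.isProbabilityMeasure_map (by fun_prop)
  refine eq_of_forall_ge_iff fun x => ?_
  rw [VaR_le_iff hα, distFun_map_add_const, ← VaR_le_iff hα, le_sub_iff_add_le]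

theorem densityAt_map_add_const (ν : Measure ℝ) (c x : ℝ) :
    densityAt (ν.map (· + c)) (x + c) = densityAt ν x := by
  have : distFun (ν.map (· + c)) = fun x => distFun ν (x - c) :=
    funext (distFun_map_add_const ν c)
  rw [densityAt, this, deriv_comp_sub_const, add_sub_cancel_right, densityAt]

theorem ES_map_add_const [IsProbabilityMeasure ν] (hα : α ∈ Set.Ioo (0 : ℝ) 1)
    (hν : Integrable (fun x => x) ν) (c : ℝ) :
    ES α (ν.map (· + c)) = ES α ν + c := by
  have : IsProbabilityMeasure (ν.map (· + c)) :=
    Measure.isProbabilityMeasure_map (by fun_prop)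
  have hm : AEMeasurable (fun x : ℝ => x + c) ν := by fun_prop
  have hν' : Integrable (fun x => x) (ν.map (· + c)) :=
    (integrable_map_measure measurable_id.aestronglyMeasurable hm).2 (hν.add (integrable_const c))
  rw [ES_eq_ruFun hα hν', ES_eq_ruFun hα hν, VaR_map_add_const hα, ruFun, ruFun,
    integral_map hm (by fun_prop : Measurable fun x : ℝ =>
      max (x - (VaR α ν + c)) 0).aestronglyMeasurable]
  simp only [add_sub_add_right_eq_sub]
  ring

end Shift

/-! ### Consequences of a positive density -/

section Density

theorem measure_ne_zero_of_hasPositiveDensityOn {ν : Measure ℝ} {A B : Set ℝ}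
    (h : HasPositiveDensityOn ν A) (hB : MeasurableSet B) (hBA : B ⊆ A) (hvol : volume B ≠ 0) :
    ν B ≠ 0 := by
  obtain ⟨f, hf, hpos, heq⟩ := h
  intro h0
  have h1 : ν.restrict A B = 0 := by
    rw [Measure.restrict_apply hB, Set.inter_eq_left.2 hBA, h0]
  rw [heq, withDensity_apply_eq_zero (by fun_prop)] at h1
  have h2 : {x | ENNReal.ofReal (f x) ≠ 0} ∩ B = B := by
    refine Set.inter_eq_right.2 fun x hx => ?_
    simpa using hpos x (hBA hx)
  rw [h2, Measure.restrict_apply hB, Set.inter_eq_left.2 hBA] at h1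
  exact hvol h1

/-- Supplies the uniqueness of the marginal quantiles that the ES expansion needs: every interval to
the right of VaR carries mass. -/
theorem lt_distFun_of_hasPositiveDensityOn {ν : Measure ℝ} [IsProbabilityMeasure ν] {α : ℝ}
    (hα : α ∈ Set.Ioo (0 : ℝ) 1) (h : HasPositiveDensityOn ν (Set.Ici (VaR α ν)))
    {x : ℝ} (hx : VaR α ν < x) : 1 - α < distFun ν x := by
  have h1 : ν (Set.Ioc (VaR α ν) x) ≠ 0 :=
    measure_ne_zero_of_hasPositiveDensityOn h measurableSet_Ioc (fun z hz => hz.1.le) (by simpa using hx)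
  have h2 : 0 < ν.real (Set.Ioc (VaR α ν) x) :=
    ENNReal.toReal_pos h1 (measure_ne_top _ _)
  have h3 : distFun ν x = distFun ν (VaR α ν) + ν.real (Set.Ioc (VaR α ν) x) := by
    rw [distFun, distFun, ← Set.Iic_union_Ioc_eq_Iic hx.le,
      measureReal_union (Set.Iic_disjoint_Ioc le_rfl) measurableSet_Ioc]
  linarith [le_distFun_VaR (ν := ν) hα]

end Density

/-! ### Asymptotic variances of a portfolio and their blow-up -/

section Portfolio

variable {Ω : Type*} [MeasurableSpace Ω] {μ : Measure Ω} [IsProbabilityMeasure μ] {n : ℕ}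
  {X : Ω → Fin n → ℝ} {α : ℝ}

theorem measurable_coord (hX : Measurable X) (i : Fin n) : Measurable fun ω => X ω i :=
  (measurable_pi_apply i).comp hX

theorem measurable_total (hX : Measurable X) : Measurable fun ω => ∑ i, X ω i :=
  Finset.measurable_sum _ fun i _ => measurable_coord hX i

theorem margLaw_add_const (hX : Measurable X) (c : Fin n → ℝ) (i : Fin n) :
    margLaw μ (fun ω => X ω + c) i = (margLaw μ X i).map (· + c i) := by
  rw [margLaw, margLaw, Measure.map_map (by fun_prop) (measurable_coord hX i)]
  rfl

theorem sumLaw_add_const (hX : Measurable X) (c : Fin n → ℝ) :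
    sumLaw μ (fun ω => X ω + c) = (sumLaw μ X).map (· + ∑ i, c i) := by
  rw [sumLaw, sumLaw, Measure.map_map (by fun_prop) (measurable_total hX)]
  congr 1
  ext ω
  simp [Finset.sum_add_distrib]

theorem isProbabilityMeasure_margLaw (hX : Measurable X) (i : Fin n) :
    IsProbabilityMeasure (margLaw μ X i) :=
  Measure.isProbabilityMeasure_map (measurable_coord hX i).aemeasurable

theorem isProbabilityMeasure_sumLaw (hX : Measurable X) : IsProbabilityMeasure (sumLaw μ X) :=
  Measure.isProbabilityMeasure_map (measurable_total hX).aemeasurable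

/-- The fluctuations of the denominator in the Value-at-Risk ratio. -/
def denVaR (α : ℝ) (μ : Measure Ω) (X : Ω → Fin n → ℝ) (ω : Ω) : ℝ :=
  ∑ i, -1 / densityAt (margLaw μ X i) (VaR α (margLaw μ X i)) *
    (Set.Iic (VaR α (margLaw μ X i))).indicator (fun _ => (1 : ℝ)) (X ω i)

/-- The fluctuations of the numerator in the Value-at-Risk ratio. -/
def numVaR (α : ℝ) (μ : Measure Ω) (X : Ω → Fin n → ℝ) (ω : Ω) : ℝ :=
  -1 / densityAt (sumLaw μ X) (VaR α (sumLaw μ X)) *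
    (Set.Iic (VaR α (sumLaw μ X))).indicator (fun _ => (1 : ℝ)) (∑ i, X ω i)

/-- The fluctuations of the denominator in the Expected-Shortfall ratio. -/
def denES (α : ℝ) (μ : Measure Ω) (X : Ω → Fin n → ℝ) (ω : Ω) : ℝ :=
  ∑ i, α⁻¹ * max (X ω i - VaR α (margLaw μ X i)) 0

/-- The fluctuations of the numerator in the Expected-Shortfall ratio. -/
def numES (α : ℝ) (μ : Measure Ω) (X : Ω → Fin n → ℝ) (ω : Ω) : ℝ :=
  α⁻¹ * max (∑ i, X ω i - VaR α (sumLaw μ X)) 0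

theorem memLp_excess {Y : Ω → ℝ} (hY : MemLp Y 2 μ) (t : ℝ) :
    MemLp (fun ω => max (Y ω - t) 0) 2 μ :=
  (hY.sub (memLp_const t)).pos_part

theorem memLp_denVaR (hX : Measurable X) : MemLp (denVaR α μ X) 2 μ :=
  memLp_finsetSum _ fun i _ =>
    (memLp_indicator_comp (measurable_coord hX i) measurableSet_Iic).const_mul _

theorem memLp_numVaR (hX : Measurable X) : MemLp (numVaR α μ X) 2 μ :=
  (memLp_indicator_comp (measurable_total hX) measurableSet_Iic).const_mul _

theorem memLp_denES (hX : ∀ i, MemLp (fun ω => X ω i) 2 μ) : MemLp (denES α μ X) 2 μ :=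
  memLp_finsetSum _ fun i _ => (memLp_excess (hX i) _).const_mul _

theorem memLp_numES (hX : ∀ i, MemLp (fun ω => X ω i) 2 μ) : MemLp (numES α μ X) 2 μ :=
  (memLp_excess (memLp_finsetSum _ fun i _ => hX i) _).const_mul _

theorem asymVarVaR_eq (hX : Measurable X) :
    asymVarVaR α μ X = ratioVar μ (VaR α (sumLaw μ X)) (∑ i, VaR α (margLaw μ X i))
      (denVaR α μ X) (numVaR α μ X) := by
  have hV : ∀ i, MemLp (fun ω => indicatorVec α μ X ω i) 2 μ := by
    intro i
    refine Fin.lastCases ?_ (fun i => ?_) i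
    · simpa [indicatorVec] using memLp_indicator_comp (measurable_total hX) measurableSet_Iic
    · simpa [indicatorVec] using memLp_indicator_comp (measurable_coord hX i) measurableSet_Iic
  rw [asymVarVaR, dotProduct_covMat_mulVec hV, ratioVar]
  congr 1
  ext ω
  simp only [Fin.sum_univ_castSucc, weightVaR, indicatorVec, Fin.snoc_castSucc, Fin.snoc_last,
    denVaR, numVaR, Finset.mul_sum]
  congr 1
  · refine Finset.sum_congr rfl fun i _ => ?_
    simp only [div_eq_mul_inv, mul_inv]
    ring
  · rw [← mul_assoc, div_mul_div_comm, one_mul, ← Finset.mul_sum, mul_comm (densityAt _ _)]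

theorem asymVarES_eq (hX : ∀ i, MemLp (fun ω => X ω i) 2 μ) :
    asymVarES α μ X = ratioVar μ (ES α (sumLaw μ X)) (∑ i, ES α (margLaw μ X i))
      (denES α μ X) (numES α μ X) := by
  have hV : ∀ i, MemLp (fun ω => excessVec α μ X ω i) 2 μ := by
    intro i
    refine Fin.lastCases ?_ (fun i => ?_) i
    · simpa [excessVec] using memLp_excess (memLp_finsetSum _ fun i _ => hX i) _
    · simpa [excessVec] using memLp_excess (hX i) _
  rw [asymVarES, dotProduct_covMat_mulVec hV, ratioVar]
  congr 1
  ext ω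
  simp only [Fin.sum_univ_castSucc, weightES, excessVec, Pi.smul_apply, smul_eq_mul,
    Fin.snoc_castSucc, Fin.snoc_last, denES, numES, Finset.mul_sum]
  congr 1
  · refine Finset.sum_congr rfl fun i _ => ?_
    ring
  · ring

theorem VaR_margLaw_add_const (hX : Measurable X) (hα : α ∈ Set.Ioo (0 : ℝ) 1)
    (c : Fin n → ℝ) (i : Fin n) :
    VaR α (margLaw μ (fun ω => X ω + c) i) = VaR α (margLaw μ X i) + c i := by
  have := isProbabilityMeasure_margLaw (μ := μ) hX i
  rw [margLaw_add_const hX, VaR_map_add_const hα]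

theorem VaR_sumLaw_add_const (hX : Measurable X) (hα : α ∈ Set.Ioo (0 : ℝ) 1)
    (c : Fin n → ℝ) :
    VaR α (sumLaw μ (fun ω => X ω + c)) = VaR α (sumLaw μ X) + ∑ i, c i := by
  have := isProbabilityMeasure_sumLaw (μ := μ) hX
  rw [sumLaw_add_const hX, VaR_map_add_const hα]

/-- Losses and quantiles move together and the density at the quantile is preserved. Hence a shift
affects the asymptotic variance only through the values of numerator and denominator. -/
theorem denVaR_add_const (hX : Measurable X) (hα : α ∈ Set.Ioo (0 : ℝ) 1)
    (c : Fin n → ℝ) : denVaR α μ (fun ω => X ω + c) = denVaR α μ X := by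
  ext ω
  refine Finset.sum_congr rfl fun i _ => ?_
  rw [VaR_margLaw_add_const hX hα, margLaw_add_const hX, densityAt_map_add_const]
  simp [Set.indicator_apply]

theorem numVaR_add_const (hX : Measurable X) (hα : α ∈ Set.Ioo (0 : ℝ) 1)
    (c : Fin n → ℝ) : numVaR α μ (fun ω => X ω + c) = numVaR α μ X := by
  ext ω
  rw [numVaR, VaR_sumLaw_add_const hX hα, sumLaw_add_const hX, densityAt_map_add_const, numVaR]
  simp [Set.indicator_apply, Finset.sum_add_distrib]

theorem denES_add_const (hX : Measurable X) (hα : α ∈ Set.Ioo (0 : ℝ) 1)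
    (c : Fin n → ℝ) : denES α μ (fun ω => X ω + c) = denES α μ X := by
  ext ω
  refine Finset.sum_congr rfl fun i _ => ?_
  rw [VaR_margLaw_add_const hX hα]
  simp

theorem numES_add_const (hX : Measurable X) (hα : α ∈ Set.Ioo (0 : ℝ) 1)
    (c : Fin n → ℝ) : numES α μ (fun ω => X ω + c) = numES α μ X := by
  ext ω
  rw [numES, VaR_sumLaw_add_const hX hα, numES]
  simp [Finset.sum_add_distrib]

theorem ES_margLaw_add_const (hX : Measurable X) (hα : α ∈ Set.Ioo (0 : ℝ) 1)
    (c : Fin n → ℝ) (hint : ∀ i, Integrable (fun ω => X ω i) μ) (i : Fin n) :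
    ES α (margLaw μ (fun ω => X ω + c) i) = ES α (margLaw μ X i) + c i := by
  have := isProbabilityMeasure_margLaw (μ := μ) hX i
  rw [margLaw_add_const hX, ES_map_add_const hα]
  exact (integrable_map_measure measurable_id.aestronglyMeasurable
    (measurable_coord hX i).aemeasurable).2 (hint i)

theorem ES_sumLaw_add_const (hX : Measurable X) (hα : α ∈ Set.Ioo (0 : ℝ) 1)
    (c : Fin n → ℝ) (hint : ∀ i, Integrable (fun ω => X ω i) μ) :
    ES α (sumLaw μ (fun ω => X ω + c)) = ES α (sumLaw μ X) + ∑ i, c i := by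
  have := isProbabilityMeasure_sumLaw (μ := μ) hX
  rw [sumLaw_add_const hX, ES_map_add_const hα]
  exact (integrable_map_measure measurable_id.aestronglyMeasurable
    (measurable_total hX).aemeasurable).2 (integrable_finsetSum Finset.univ fun i _ => hint i)

/-- A degenerate indicator would almost surely equal its mean 1 - α, which is neither 0 nor 1. -/
theorem variance_numVaR_ne_zero (hX : Measurable X) (hα : α ∈ Set.Ioo (0 : ℝ) 1)
    (hS : HasPositiveDensityAt (sumLaw μ X) (VaR α (sumLaw μ X))) :
    variance (numVaR α μ X) μ ≠ 0 := by
  have hp := isProbabilityMeasure_sumLaw (μ := μ) hX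
  intro h
  have hg := hS.2
  set g := densityAt (sumLaw μ X) (VaR α (sumLaw μ X)) with hg_def
  obtain ⟨ω, hω⟩ := (ae_eq_integral_of_variance_eq_zero (memLp_numVaR hX) h).exists
  have hm : ∫ ω, numVaR α μ X ω ∂μ = -1 / g * (1 - α) := by
    simp only [numVaR]
    rw [integral_const_mul, integral_indicator_comp (measurable_total hX) measurableSet_Iic,
      ← hg_def]
    congr 1
    exact distFun_VaR_eq (ν := sumLaw μ X) hα hS.1.continuousAt
  rw [hm, numVaR, ← hg_def] at hω
  have h2 := mul_left_cancel₀ (div_ne_zero (by norm_num) hg.ne') hω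
  by_cases hmem : ∑ i, X ω i ∈ Set.Iic (VaR α (sumLaw μ X))
  · rw [Set.indicator_of_mem hmem] at h2
    linarith [hα.1]
  · rw [Set.indicator_of_notMem hmem] at h2
    linarith [hα.2]

/-- If the sum of nonnegative excesses were almost surely constant, each X_i would be bounded above,
contradicting a density positive on a whole half-line. -/
theorem variance_denES_ne_zero (hX : Measurable X) (hα : α ∈ Set.Ioo (0 : ℝ) 1)
    (hL : ∀ i, MemLp (fun ω => X ω i) 2 μ) (i : Fin n)
    (hd : HasPositiveDensityOn (margLaw μ X i) (Set.Ici (VaR α (margLaw μ X i)))) :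
    variance (denES α μ X) μ ≠ 0 := by
  intro h
  have hae := ae_eq_integral_of_variance_eq_zero (memLp_denES hL) h
  set m := ∫ ω, denES α μ X ω ∂μ with hm
  have hinv : 0 < α⁻¹ := inv_pos.2 hα.1
  have hle : ∀ᵐ ω ∂μ, X ω i ≤ VaR α (margLaw μ X i) + |α * m| := by
    filter_upwards [hae] with ω hω
    have h1 : α⁻¹ * max (X ω i - VaR α (margLaw μ X i)) 0 ≤ m := by
      rw [← hω]
      exact Finset.single_le_sum
        (f := fun i => α⁻¹ * max (X ω i - VaR α (margLaw μ X i)) 0)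
        (fun j _ => mul_nonneg hinv.le (le_max_right _ _)) (Finset.mem_univ i)
    rw [inv_mul_le_iff₀ hα.1] at h1
    linarith [le_max_left (X ω i - VaR α (margLaw μ X i)) 0, le_abs_self (α * m)]
  refine measure_ne_zero_of_hasPositiveDensityOn hd
    (measurableSet_Ioi (a := VaR α (margLaw μ X i) + |α * m|)) (fun x hx => ?_) (by simp) ?_
  · have := abs_nonneg (α * m)
    simp only [Set.mem_Ioi, Set.mem_Ici] at hx ⊢
    linarith
  · rw [ae_iff] at hle
    refine (Measure.map_apply (measurable_coord hX i) measurableSet_Ioi).trans ?_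
    simpa [Set.preimage] using hle

/-- Blow-up of the variance of the linearised ratio in terms of its value at the unshifted
portfolio. -/
theorem tendsto_ratioVar_of_ratio {A B : Ω → ℝ} (hA : MemLp A 2 μ) (hB : MemLp B 2 μ) {a b : ℝ}
    (hb : b ≠ 0) (hAB : variance A μ ≠ 0 ∨ variance B μ ≠ 0)
    (h : a / b ≠ 1 ∨ 0 < ratioVar μ a b A B) :
    Tendsto (fun τ => ratioVar μ (a - b + τ) τ A B) (𝓝[≠] 0) atTop := by
  refine tendsto_ratioVar_atTop hA hB (fun _ => hAB) fun hd hK => ?_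
  obtain rfl : a = b := sub_eq_zero.1 hd
  rcases h with h | h
  · exact h (div_self hb)
  -- For a = b the variance is a multiple of Var(B - A), so its positivity at the unshifted
  -- portfolio excludes degeneracy for all shifts.
  · rw [ratioVar_eq hA hB hb] at h
    have : a ^ 2 * variance A μ - 2 * a * a * covariance A B μ + a ^ 2 * variance B μ =
        a ^ 2 * (variance A μ - 2 * covariance A B μ + variance B μ) := by ring
    rw [this, hK] at h
    simp at h

/-- The shifted denominator plays the role of τ, and the shifted numerator is a - b + τ. The `comap`
filter covers every way for c to vary with τ → 0 through nonzero values. -/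
theorem tendsto_asymVarVaR_shift (hX : Measurable X) (hα : α ∈ Set.Ioo (0 : ℝ) 1)
    (hS : HasPositiveDensityAt (sumLaw μ X) (VaR α (sumLaw μ X)))
    (h0 : ∑ i, VaR α (margLaw μ X i) ≠ 0) (h : DR (VaR α) μ X ≠ 1 ∨ 0 < asymVarVaR α μ X) :
    Tendsto (fun c : Fin n → ℝ => asymVarVaR α μ (fun ω => X ω + c))
      (comap (fun c : Fin n → ℝ => ∑ i, VaR α (margLaw μ (fun ω => X ω + c) i)) (𝓝[≠] 0))
      atTop := by
  rw [asymVarVaR_eq hX] at h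
  refine ((tendsto_ratioVar_of_ratio (memLp_denVaR hX) (memLp_numVaR hX) h0
    (Or.inr (variance_numVaR_ne_zero hX hα hS)) h).comp tendsto_comap).congr fun c => ?_
  rw [asymVarVaR_eq (hX.add_const c), denVaR_add_const hX hα, numVaR_add_const hX hα,
    VaR_sumLaw_add_const hX hα, Function.comp_apply]
  simp only [VaR_margLaw_add_const hX hα, Finset.sum_add_distrib]
  congr 1
  ring

theorem tendsto_asymVarES_shift (hX : Measurable X) (hα : α ∈ Set.Ioo (0 : ℝ) 1)
    (hL : ∀ i, MemLp (fun ω => X ω i) 2 μ)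
    (hd : ∀ i, HasPositiveDensityOn (margLaw μ X i) (Set.Ici (VaR α (margLaw μ X i))))
    (h0 : ∑ i, ES α (margLaw μ X i) ≠ 0) (h : DR (ES α) μ X ≠ 1 ∨ 0 < asymVarES α μ X) :
    Tendsto (fun c : Fin n → ℝ => asymVarES α μ (fun ω => X ω + c))
      (comap (fun c : Fin n → ℝ => ∑ i, ES α (margLaw μ (fun ω => X ω + c) i)) (𝓝[≠] 0))
      atTop := by
  -- A nonzero sum provides an index, so the portfolio is not empty.
  obtain ⟨i, -, -⟩ := Finset.exists_ne_zero_of_sum_ne_zero h0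
  have hint : ∀ i, Integrable (fun ω => X ω i) μ := fun i => (hL i).integrable one_le_two
  rw [asymVarES_eq hL] at h
  refine ((tendsto_ratioVar_of_ratio (memLp_denES hL) (memLp_numES hL) h0
    (Or.inl (variance_denES_ne_zero hX hα hL i (hd i))) h).comp tendsto_comap).congr fun c => ?_
  have hLc : ∀ i, MemLp (fun ω => (X ω + c) i) 2 μ := fun i => (hL i).add (memLp_const (c i))
  rw [asymVarES_eq hLc, denES_add_const hX hα,
    numES_add_const hX hα, ES_sumLaw_add_const hX hα c hint, Function.comp_apply]
  simp only [ES_margLaw_add_const hX hα c hint, Finset.sum_add_distrib]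
  congr 1
  ring

end Portfolio

end

/-! ### The main theorem -/

theorem proposition5 {Ω : Type*} [MeasurableSpace Ω] (μ : Measure Ω) [IsProbabilityMeasure μ]
    (n : ℕ) (X : Ω → Fin n → ℝ) (hX : Measurable X)
    (Xs : ℕ → Ω → Fin n → ℝ) (hXs : ∀ k, Measurable (Xs k))
    (hindep : iIndepFun Xs μ) (hident : ∀ k, IdentDistrib (Xs k) X μ μ)
    (α : ℝ) (hα : α ∈ Set.Ioo (0 : ℝ) 1) :
    -- (i) Value at Risk
    ((∀ i, HasPositiveDensityAt (margLaw μ X i) (VaR α (margLaw μ X i))) →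
      HasPositiveDensityAt (sumLaw μ X) (VaR α (sumLaw μ X)) →
      ∑ i, VaR α (margLaw μ X i) ≠ 0 →
      TendstoInDistribution
          (fun (N : ℕ) ω => √(N : ℝ) * (empDR (VaR α) (fun k => Xs k ω) N - DR (VaR α) μ X))
          atTop (id : ℝ → ℝ) (fun _ => μ) (gaussianReal 0 (asymVarVaR α μ X).toNNReal) ∧
        -- blow-up along location shifts of the portfolio
        (DR (VaR α) μ X ≠ 1 ∨ 0 < asymVarVaR α μ X →
          Tendsto (fun c : Fin n → ℝ => asymVarVaR α μ (fun ω => X ω + c))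
            (comap (fun c : Fin n → ℝ => ∑ i, VaR α (margLaw μ (fun ω => X ω + c) i)) (𝓝[≠] 0))
            atTop)) ∧
    -- (ii) Expected Shortfall
    ((∀ i, HasPositiveDensityOn (margLaw μ X i) (Set.Ici (VaR α (margLaw μ X i)))) →
      (∀ i, ∃ ε > 0, MemLp (fun ω => X ω i) (ENNReal.ofReal (2 + ε)) μ) →
      (∀ x > VaR α (sumLaw μ X), 1 - α < distFun (sumLaw μ X) x) →
      ∑ i, ES α (margLaw μ X i) ≠ 0 →
      TendstoInDistribution
          (fun (N : ℕ) ω => √(N : ℝ) * (empDR (ES α) (fun k => Xs k ω) N - DR (ES α) μ X))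
          atTop (id : ℝ → ℝ) (fun _ => μ) (gaussianReal 0 (asymVarES α μ X).toNNReal) ∧
        -- blow-up along location shifts of the portfolio
        (DR (ES α) μ X ≠ 1 ∨ 0 < asymVarES α μ X →
          Tendsto (fun c : Fin n → ℝ => asymVarES α μ (fun ω => X ω + c))
            (comap (fun c : Fin n → ℝ => ∑ i, ES α (margLaw μ (fun ω => X ω + c) i)) (𝓝[≠] 0))
            atTop)) := by
  have hcoord : ∀ i k, Measurable fun ω => Xs k ω i := fun i k => measurable_coord (hXs k) i
  have htotal : ∀ k, Measurable fun ω => ∑ i, Xs k ω i := fun k => measurable_total (hXs k)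
  have hindep_coord : ∀ i : Fin n, iIndepFun (fun k ω => Xs k ω i) μ := fun i =>
    hindep.comp (fun _ y => y i) fun _ => measurable_pi_apply i
  have hindep_total : iIndepFun (fun k ω => ∑ i, Xs k ω i) μ :=
    hindep.comp (fun _ y => ∑ i, y i) fun _ => by fun_prop
  have hident_coord : ∀ (i : Fin n) k, IdentDistrib (fun ω => Xs k ω i) (fun ω => X ω i) μ μ :=
    fun i k => (hident k).comp (measurable_pi_apply i)
  have hident_total : ∀ k, IdentDistrib (fun ω => ∑ i, Xs k ω i) (fun ω => ∑ i, X ω i) μ μ :=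
    fun k => (hident k).comp (u := fun y : Fin n → ℝ => ∑ i, y i) (by fun_prop)
  refine ⟨fun hF hG h0 => ⟨?_, tendsto_asymVarVaR_shift hX hα hG h0⟩,
    fun hF hmom hG h0 => ?_⟩
  · rw [asymVarVaR_eq hX]
    exact tendstoInDistribution_empDR (VaR α) hindep hident
      (fun i => measurable_indicator_one measurableSet_Iic)
      (measurable_indicator_one measurableSet_Iic)
      (fun i => memLp_indicator_comp (measurable_coord hX i) measurableSet_Iic)
      (memLp_indicator_comp (measurable_total hX) measurableSet_Iic) _ _
      (fun i => measurable_VaR_empLaw (hcoord i) hα) (measurable_VaR_empLaw htotal hα)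
      (fun i => smallOP_VaR_empLaw (measurable_coord hX i) (hindep_coord i) (hident_coord i) hα
        (hF i))
      (smallOP_VaR_empLaw (measurable_total hX) hindep_total hident_total hα hG) h0
  · have hL : ∀ i, MemLp (fun ω => X ω i) 2 μ := by
      intro i
      obtain ⟨ε, hε, h⟩ := hmom i
      refine h.mono_exponent ?_
      rw [← ENNReal.ofReal_ofNat]
      exact ENNReal.ofReal_le_ofReal (by linarith)
    have hLS : MemLp (fun ω => ∑ i, X ω i) 2 μ := memLp_finsetSum _ fun i _ => hL i
    refine ⟨?_, tendsto_asymVarES_shift hX hα hL hF h0⟩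
    rw [asymVarES_eq hL]
    refine tendstoInDistribution_empDR (ES α) hindep hident
      (ψ := fun i x => max (x - VaR α (margLaw μ X i)) 0)
      (ψS := fun x => max (x - VaR α (sumLaw μ X)) 0) (fun i => by fun_prop) (by fun_prop)
      (fun i => memLp_excess (hL i) _) (memLp_excess hLS _) _ _
      (fun i => measurable_ES_empLaw (hcoord i) hα) (measurable_ES_empLaw htotal hα)
      (fun i => ?_)
      (smallOP_ES_empLaw (measurable_total hX) (hLS.integrable one_le_two) hindep_total
        hident_total hα hG) h0
    have := isProbabilityMeasure_margLaw (μ := μ) hX i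
    exact smallOP_ES_empLaw (measurable_coord hX i) ((hL i).integrable one_le_two)
      (hindep_coord i) (hident_coord i) hα fun x hx =>
        lt_distFun_of_hasPositiveDensityOn hα (hF i) hx
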